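/- Let $p$ be a prime number and let $R$ be a Noetherian integral domain of characteristic $0$ (equivalently, whose fraction field has characteristic $0$) which is $p$-adically complete, i.e. the natural map $R\to\varprojlim_n R/p^nR$ is an isomorphism. Let $G$ be a finite group and let $n$ be an integer, $n\ge 0$, with $p^n>2$; write $R_n=R/p^nR$. Then the map $K_2(R[G])\to K_2(R_n[G])$ induced by the reduction $R[G]\to R_n[G]$ of coefficients modulo $p^n$ is surjective. Here, for a ring $S$, $K_2(S)=\ker(\mathrm{St}(S)\to \mathrm{GL}(S))$ is Milnor's $K_2$: $\mathrm{GL}(S)=\bigcup_m \mathrm{GL}_m(S)$ is the stable general linear group, and $\mathrm{St}(S)$ is the stable Steinberg group, with generators $x_{ij}(a)$ ($i\ne j$ natural numbers, $a\in S$) and relations $x_{ij}(a)x_{ij}(b)=x_{ij}(a+b)$, $[x_{ij}(a),x_{jk}(b)]=x_{ik}(ab)$ for $i\neq k$, and $[x_{ij}(a),x_{kl}(b)]=1$ for $j\ne k$, $i\neq l$; the generator $x_{ij}(a)$ maps to the elementary matrix $e_{ij}(a)$. -/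

import Mathlib

/-!
The stable general linear group `GL(S)`, the Steinberg group `St(S)` and Milnor's group
`K₂(S) = ker (St(S) → GL(S))` of an arbitrary (not necessarily commutative) ring `S`.

Infinite matrices over `S` are written as endomorphisms of the right `S`-module of finitely
supported column vectors `ℕ →₀ S`; composition is then the product of matrices, and the `j`-th
column of `u` is `u (Finsupp.single j 1)`.
-/

namespace AlgK

section Rings

variable (S : Type*) [Ring S]

/-- The right `S`-module of finitely supported column vectors. -/
abbrev Col : Type _ := ℕ →₀ S

/-- The stable general linear group `GL(S) = ⋃ₙ GLₙ(S)`: the invertible infinite matrices whose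
columns and rows with index `≥ n`, for some `n`, are those of the identity matrix. -/
def StableGL : Subgroup (Module.End Sᵐᵒᵖ (Col S))ˣ where
  carrier := {u | ∃ n : ℕ, ∀ i ≥ n,
    (u : Module.End Sᵐᵒᵖ (Col S)) (Finsupp.single i 1) = Finsupp.single i 1 ∧
    ∀ v : Col S, (u : Module.End Sᵐᵒᵖ (Col S)) v i = v i}
  one_mem' := ⟨0, fun i _ => ⟨rfl, fun _ => rfl⟩⟩
  mul_mem' := by
    rintro a b ⟨m, hm⟩ ⟨n, hn⟩
    refine ⟨max m n, fun i hi => ?_⟩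
    have h1 := hm i (le_trans (le_max_left _ _) hi)
    have h2 := hn i (le_trans (le_max_right _ _) hi)
    refine ⟨?_, fun v => ?_⟩
    · rw [Units.val_mul, Module.End.mul_apply, h2.1, h1.1]
    · rw [Units.val_mul, Module.End.mul_apply, h1.2, h2.2]
  inv_mem' := by
    rintro a ⟨n, hn⟩
    have key : ∀ v : Col S, (a⁻¹ : (Module.End Sᵐᵒᵖ (Col S))ˣ).val (a.val v) = v := fun v => by
      rw [← Module.End.mul_apply, a.inv_mul, Module.End.one_apply]
    have key' : ∀ v : Col S, a.val ((a⁻¹ : (Module.End Sᵐᵒᵖ (Col S))ˣ).val v) = v := fun v => by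
      rw [← Module.End.mul_apply, a.mul_inv, Module.End.one_apply]
    refine ⟨n, fun i hi => ⟨?_, fun v => ?_⟩⟩
    · have h := key (Finsupp.single i 1)
      rwa [(hn i hi).1] at h
    · rw [← (hn i hi).2, key']

variable {S}

/-- The elementary matrix `1 + a Eᵢⱼ` as an endomorphism of the column vectors. -/
noncomputable def elemEnd (i j : ℕ) (a : S) : Module.End Sᵐᵒᵖ (Col S) where
  toFun v := v + Finsupp.single i (a * v j)
  map_add' v w := by
    rw [Finsupp.add_apply, mul_add, Finsupp.single_add]; abel
  map_smul' c v := by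
    ext k
    by_cases h : i = k <;> simp [h, mul_assoc]

theorem elemEnd_apply (i j : ℕ) (a : S) (v : Col S) :
    elemEnd i j a v = v + Finsupp.single i (a * v j) := rfl

theorem elemEnd_mul {i j : ℕ} (h : i ≠ j) (a b : S) :
    elemEnd i j a * elemEnd i j b = elemEnd i j (a + b) := by
  refine LinearMap.ext fun v => ?_
  simp only [Module.End.mul_apply, elemEnd_apply, Finsupp.add_apply,
    Finsupp.single_eq_of_ne h.symm, add_zero, add_mul, Finsupp.single_add]
  abel

theorem elemEnd_zero (i j : ℕ) : elemEnd i j (0 : S) = 1 := by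
  refine LinearMap.ext fun v => ?_
  simp [elemEnd_apply]

/-- The elementary matrix `eᵢⱼ(a) = 1 + a Eᵢⱼ`, for `i ≠ j`, as an element of `GL(S)`. -/
noncomputable def elem (i j : ℕ) (h : i ≠ j) (a : S) : StableGL S :=
  ⟨⟨elemEnd i j a, elemEnd i j (-a), by rw [elemEnd_mul h, add_neg_cancel, elemEnd_zero],
      by rw [elemEnd_mul h, neg_add_cancel, elemEnd_zero]⟩, by
    refine ⟨max i j + 1, fun k hk => ?_⟩
    have hi : i ≠ k := by omega
    have hj : j ≠ k := by omega
    refine ⟨?_, fun v => ?_⟩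
    · change Finsupp.single k 1 + Finsupp.single i (a * (Finsupp.single k (1 : S)) j) = _
      rw [Finsupp.single_eq_of_ne hj, mul_zero, Finsupp.single_zero, add_zero]
    · change (v + Finsupp.single i (a * v j)) k = v k
      rw [Finsupp.add_apply, Finsupp.single_eq_of_ne hi.symm, add_zero]⟩

theorem elem_apply (i j : ℕ) (h : i ≠ j) (a : S) (v : Col S) :
    (elem i j h a).1.1 v = v + Finsupp.single i (a * v j) := rfl

theorem StableGL.ext {x y : StableGL S} (h : ∀ v : Col S, x.1.1 v = y.1.1 v) : x = y :=
  Subtype.ext (Units.ext (LinearMap.ext h))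

theorem StableGL.mul_apply (x y : StableGL S) (v : Col S) : (x * y).1.1 v = x.1.1 (y.1.1 v) := rfl

variable (S)

/-- The generators `xᵢⱼ(a)`, with `i ≠ j` and `a ∈ S`, of the Steinberg group. -/
structure SteinbergGen where
  /-- the row index -/
  i : ℕ
  /-- the column index -/
  j : ℕ
  /-- the indices are distinct -/
  ne : i ≠ j
  /-- the entry -/
  a : S

variable {S}

/-- The generator `xᵢⱼ(a)` in the free group. -/
def gen (i j : ℕ) (h : i ≠ j) (a : S) : FreeGroup (SteinbergGen S) :=
  FreeGroup.of ⟨i, j, h, a⟩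

variable (S)

open scoped commutatorElement in
/-- The Steinberg relators. -/
inductive SteinbergRel : FreeGroup (SteinbergGen S) → Prop
  /-- `xᵢⱼ(a) xᵢⱼ(b) = xᵢⱼ(a + b)` -/
  | add (i j : ℕ) (h : i ≠ j) (a b : S) :
      SteinbergRel (gen i j h a * gen i j h b * (gen i j h (a + b))⁻¹)
  /-- `[xᵢⱼ(a), xⱼₖ(b)] = xᵢₖ(ab)` for `i ≠ k` -/
  | comm (i j k : ℕ) (hij : i ≠ j) (hjk : j ≠ k) (hik : i ≠ k) (a b : S) :
      SteinbergRel (⁅gen i j hij a, gen j k hjk b⁆ * (gen i k hik (a * b))⁻¹)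
  /-- `[xᵢⱼ(a), xₖₗ(b)] = 1` for `j ≠ k` and `i ≠ l` -/
  | comm_one (i j k l : ℕ) (hij : i ≠ j) (hkl : k ≠ l) (hjk : j ≠ k) (hil : i ≠ l) (a b : S) :
      SteinbergRel ⁅gen i j hij a, gen k l hkl b⁆

/-- The (stable) Steinberg group `St(S)`. -/
abbrev St : Type _ := PresentedGroup {r : FreeGroup (SteinbergGen S) | SteinbergRel S r}

open scoped commutatorElement in
theorem SteinbergRel.lift_eq_one {H : Type*} [Group H] (f : SteinbergGen S → H)
    (h1 : ∀ i j h a b, f ⟨i, j, h, a⟩ * f ⟨i, j, h, b⟩ = f ⟨i, j, h, a + b⟩)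
    (h2 : ∀ i j k hij hjk hik a b,
      f ⟨i, j, hij, a⟩ * f ⟨j, k, hjk, b⟩ =
        f ⟨i, k, hik, a * b⟩ * (f ⟨j, k, hjk, b⟩ * f ⟨i, j, hij, a⟩))
    (h3 : ∀ i j k l hij hkl, j ≠ k → i ≠ l → ∀ a b,
      f ⟨i, j, hij, a⟩ * f ⟨k, l, hkl, b⟩ = f ⟨k, l, hkl, b⟩ * f ⟨i, j, hij, a⟩)
    (r : FreeGroup (SteinbergGen S)) (hr : r ∈ {r | SteinbergRel S r}) :
    FreeGroup.lift f r = 1 := by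
  rcases hr with ⟨i, j, h, a, b⟩ | ⟨i, j, k, hij, hjk, hik, a, b⟩ |
    ⟨i, j, k, l, hij, hkl, hjk, hil, a, b⟩
  · simp only [map_mul, map_inv, gen, FreeGroup.lift_apply_of]
    rw [h1, mul_inv_cancel]
  · simp only [map_mul, map_inv, gen, FreeGroup.lift_apply_of, commutatorElement_def]
    rw [h2 i j k hij hjk hik]; group
  · simp only [map_mul, map_inv, gen, FreeGroup.lift_apply_of, commutatorElement_def]
    rw [h3 i j k l hij hkl hjk hil]; group

/-- The homomorphism `St(S) → GL(S)`, `xᵢⱼ(a) ↦ eᵢⱼ(a)`. -/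
noncomputable def St.toGL : St S →* StableGL S :=
  PresentedGroup.toGroup (f := fun x : SteinbergGen S => elem x.i x.j x.ne x.a) <| by
    refine SteinbergRel.lift_eq_one S _ ?_ ?_ ?_
    · intro i j h a b
      refine StableGL.ext fun v => ?_
      simp only [StableGL.mul_apply, elem_apply, Finsupp.add_apply,
        Finsupp.single_eq_of_ne h.symm, add_zero, add_mul, Finsupp.single_add]
      abel
    · intro i j k hij hjk hik a b
      refine StableGL.ext fun v => ?_
      simp only [StableGL.mul_apply, elem_apply, Finsupp.add_apply, Finsupp.single_eq_same,
        Finsupp.single_eq_of_ne hjk.symm,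
        Finsupp.single_eq_of_ne hik.symm, add_zero, mul_add, Finsupp.single_add, mul_assoc]
      abel
    · intro i j k l hij hkl hjk hil a b
      refine StableGL.ext fun v => ?_
      simp only [StableGL.mul_apply, elem_apply, Finsupp.add_apply,
        Finsupp.single_eq_of_ne hjk, Finsupp.single_eq_of_ne hil.symm, add_zero]
      abel

/-- Milnor's group `K₂(S)`, the kernel of `St(S) → GL(S)`. -/
noncomputable def K₂ : Subgroup (St S) := (St.toGL S).ker

end Rings

section Functoriality

variable {S T : Type*} [Ring S] [Ring T]

theorem St.toGL_of (x : SteinbergGen S) :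
    St.toGL S (PresentedGroup.of x) = elem x.i x.j x.ne x.a :=
  PresentedGroup.toGroup.of _

/-- The image in `St(S)` of each generator satisfies the Steinberg relations. -/
theorem St.mk_eq_one {r : FreeGroup (SteinbergGen S)} (h : SteinbergRel S r) :
    PresentedGroup.mk {r : FreeGroup (SteinbergGen S) | SteinbergRel S r} r = 1 :=
  PresentedGroup.one_of_mem h

/-- The homomorphism `St(S) → St(T)`, `xᵢⱼ(a) ↦ xᵢⱼ(f a)`, induced by a ring homomorphism `f`. -/
noncomputable def St.map (f : S →+* T) : St S →* St T :=
  PresentedGroup.toGroup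
    (f := fun x : SteinbergGen S => PresentedGroup.of ⟨x.i, x.j, x.ne, f x.a⟩) <| by
    refine SteinbergRel.lift_eq_one S _ ?_ ?_ ?_
    · intro i j h a b
      have := St.mk_eq_one (SteinbergRel.add i j h (f a) (f b))
      rw [map_mul, map_inv, mul_inv_eq_one] at this
      simp only [map_add]
      exact this
    · intro i j k hij hjk hik a b
      have := St.mk_eq_one (SteinbergRel.comm i j k hij hjk hik (f a) (f b))
      rw [commutatorElement_def, map_mul, map_inv, mul_inv_eq_one, map_mul, map_mul, map_mul,
        map_inv, map_inv, mul_inv_eq_iff_eq_mul, mul_inv_eq_iff_eq_mul, mul_assoc] at this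
      simp only [map_mul]
      exact this
    · intro i j k l hij hkl hjk hil a b
      have := St.mk_eq_one (SteinbergRel.comm_one i j k l hij hkl hjk hil (f a) (f b))
      rw [commutatorElement_def, map_mul, map_mul, map_mul, map_inv, map_inv, mul_inv_eq_one,
        mul_inv_eq_iff_eq_mul] at this
      exact this

theorem St.map_of (f : S →+* T) (x : SteinbergGen S) :
    St.map f (PresentedGroup.of x) = PresentedGroup.of ⟨x.i, x.j, x.ne, f x.a⟩ :=
  PresentedGroup.toGroup.of _

/-- The homomorphism `St(S) → GL(S)` is natural in `S`. -/
theorem St.toGL_map (f : S →+* T) (x : St S) (v : Col S) :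
    (St.toGL T (St.map f x)).1.1 (v.mapRange f (map_zero f)) =
      ((St.toGL S x).1.1 v).mapRange f (map_zero f) := by
  let P : Subgroup (St S) :=
    { carrier := {x | ∀ v : Col S, (St.toGL T (St.map f x)).1.1 (v.mapRange f (map_zero f)) =
        ((St.toGL S x).1.1 v).mapRange f (map_zero f)}
      one_mem' := fun v => by simp
      mul_mem' := fun {a b} ha hb v => by
        rw [map_mul, map_mul, map_mul, StableGL.mul_apply, StableGL.mul_apply, hb v, ha]
      inv_mem' := fun {a} ha v => by
        have h := ha ((St.toGL S a⁻¹).1.1 v)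
        rw [← StableGL.mul_apply, ← map_mul, mul_inv_cancel, map_one] at h
        have h' := congrArg (St.toGL T (St.map f a⁻¹)).1.1 h
        rw [← StableGL.mul_apply, ← map_mul, ← map_mul, inv_mul_cancel, map_one, map_one] at h'
        exact h'.symm }
  suffices h : ∀ x, x ∈ P from h x v
  intro x
  have htop : P = ⊤ := by
    rw [eq_top_iff, ← PresentedGroup.closure_range_of, Subgroup.closure_le]
    rintro _ ⟨g, rfl⟩ v
    rw [St.map_of, St.toGL_of, St.toGL_of, elem_apply, elem_apply]
    ext k
    by_cases h : g.i = k <;> simp [h]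
  rw [htop]; trivial

theorem St.map_mem_K₂ (f : S →+* T) {x : St S} (hx : x ∈ K₂ S) : St.map f x ∈ K₂ T := by
  have hx' : St.toGL S x = 1 := hx
  change St.toGL T (St.map f x) = 1
  refine Subtype.ext (Units.ext ?_)
  refine LinearMap.ext fun v => ?_
  change (St.toGL T (St.map f x)).1.1 v = v
  induction v using Finsupp.induction_linear with
  | zero => exact map_zero _
  | add v w hv hw => rw [map_add, hv, hw]
  | single i a =>
    have h := St.toGL_map f x (Finsupp.single i 1)
    rw [hx'] at h
    change _ = (Finsupp.single i (1 : S)).mapRange f (map_zero f) at h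
    rw [Finsupp.mapRange_single, map_one] at h
    have ha : (Finsupp.single i a : Col T) = MulOpposite.op a • Finsupp.single i (1 : T) := by
      simp
    rw [ha, map_smul, h]

/-- The homomorphism `K₂(S) → K₂(T)` induced by a ring homomorphism `S → T`. -/
noncomputable def K₂.map (f : S →+* T) : K₂ S →* K₂ T :=
  ((St.map f).comp (K₂ S).subtype).codRestrict (K₂ T) fun x => St.map_mem_K₂ f x.2

end Functoriality

end AlgK

/-! Write S = R[G] and T = R_n[G]. Lift a class of K₂(T) to x in St(S); its matrix u is elementary
and congruent to 1 modulo p^n. If u is also the matrix of some z in ker(St(S) → St(T)), then x z⁻¹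
lies in K₂(S) and maps to the given class (`K₂.map_surjective_of`). Elements of S congruent to 1
modulo p are units, since p lies in the Jacobson radical of R, so Gaussian elimination by relative
elementary matrices reduces u to a single unit v ≡ 1 mod p^n with trivial class in K₁(S)
(`exists_eq_dilation`).

It remains to write v as a product of commutators [w, g] with w ≡ 1 mod p^n, because these are
relative elementary (`dilation_commutator_mem_relElem`). For each cyclic subgroup C, S is a free
right module over the commutative ring R[C], so v has a determinant there, and it is 1 because v is
stably elementary (`det_eq_one_of_dilation_mem_range`). For a unit 1 + p^N y with all these
determinants equal to 1, first-order terms show that p divides the sum of the coefficients of y over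
each conjugacy class (`dvd_classSum`). Hence y is modulo p a sum of differences r h - r khk⁻¹, which
are the first-order parts of commutators of 1 + p^N r h with k. The parameters r of one fixed finite
product of commutators are thus corrected digit by digit, and completeness of R gives a limit
(`exists_eq_conjCommutatorProd`).

The delicate point is that the trace over R[C] yields a class sum only up to an integer p^e c with p
∤ c. Raising the unit to the power p^e compensates for p^e, and this is where p^n > 2 is needed. -/

namespace AlgK

/-! ### Diagonal matrices and Whitehead's lemma -/

section Rings

variable {S : Type*} [Ring S]

/-- The endomorphism of the column vectors which multiplies the `i`-th coordinate by `s`. -/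
noncomputable def dilationEnd (i : ℕ) (s : S) : Module.End Sᵐᵒᵖ (Col S) where
  toFun v := v + Finsupp.single i ((s - 1) * v i)
  map_add' v w := by
    rw [Finsupp.add_apply, mul_add, Finsupp.single_add]; abel
  map_smul' c v := by
    ext k
    by_cases h : i = k <;> simp [h, mul_assoc]

theorem dilationEnd_apply (i : ℕ) (s : S) (v : Col S) :
    dilationEnd i s v = v + Finsupp.single i ((s - 1) * v i) := rfl

theorem dilationEnd_mul (i : ℕ) (s t : S) :
    dilationEnd i s * dilationEnd i t = dilationEnd i (s * t) := by
  refine LinearMap.ext fun v => ?_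
  simp only [Module.End.mul_apply, dilationEnd_apply]
  rw [add_assoc, ← Finsupp.single_add]
  congr 2
  simp only [Finsupp.add_apply, Finsupp.single_eq_same]
  noncomm_ring

theorem dilationEnd_one (i : ℕ) : dilationEnd i (1 : S) = 1 := by
  refine LinearMap.ext fun v => ?_
  simp [dilationEnd_apply]

/-- The diagonal matrix with entry `s` at the place `i` and `1` elsewhere. -/
noncomputable def dilation (i : ℕ) (s : Sˣ) : StableGL S :=
  ⟨⟨dilationEnd i s, dilationEnd i (s⁻¹ : Sˣ), by rw [dilationEnd_mul, s.mul_inv, dilationEnd_one],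
      by rw [dilationEnd_mul, s.inv_mul, dilationEnd_one]⟩, by
    refine ⟨i + 1, fun k hk => ?_⟩
    have hi : i ≠ k := by omega
    refine ⟨?_, fun v => ?_⟩
    · change Finsupp.single k 1 + Finsupp.single i (_ * (Finsupp.single k (1 : S)) i) = _
      rw [Finsupp.single_eq_of_ne hi, mul_zero, Finsupp.single_zero, add_zero]
    · change (dilationEnd i (s : S) v) k = v k
      rw [dilationEnd_apply, Finsupp.add_apply, Finsupp.single_eq_of_ne hi.symm, add_zero]⟩

theorem dilation_apply (i : ℕ) (s : Sˣ) (v : Col S) :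
    (dilation i s).1.1 v = v + Finsupp.single i ((s - 1) * v i) := rfl

theorem dilation_mul (i : ℕ) (s t : Sˣ) :
    dilation i s * dilation i t = dilation i (s * t) :=
  Subtype.ext (Units.ext (dilationEnd_mul i _ _))

/-- `dilation` as a homomorphism. -/
noncomputable def dilationHom (i : ℕ) : Sˣ →* StableGL S :=
  MonoidHom.mk' (dilation i) fun s t => (dilation_mul i s t).symm

theorem dilation_inv (i : ℕ) (s : Sˣ) : (dilation i s)⁻¹ = dilation i s⁻¹ :=
  (map_inv (dilationHom i) s).symm

theorem dilation_comm {i j : ℕ} (h : i ≠ j) (s t : Sˣ) :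
    dilation i s * dilation j t = dilation j t * dilation i s := by
  refine StableGL.ext fun v => ?_
  simp only [StableGL.mul_apply, dilation_apply, Finsupp.add_apply, Finsupp.single_eq_of_ne h,
    Finsupp.single_eq_of_ne h.symm, add_zero]
  abel

/-- Whitehead's lemma: `diag(s, s⁻¹)` is a product of elementary matrices. -/
theorem elem_mul_eq_dilation {i j : ℕ} (h : i ≠ j) (s : Sˣ) :
    elem j i h.symm ((s⁻¹ : Sˣ) - 1 : S) * elem i j h 1 * elem j i h.symm ((s : S) - 1) *
      elem i j h (-((s⁻¹ : Sˣ) : S)) = dilation i s * dilation j s⁻¹ := by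
  refine StableGL.ext fun v => ?_
  ext k
  simp only [StableGL.mul_apply, dilation_apply, elem_apply, Finsupp.add_apply,
    Finsupp.single_eq_of_ne h, Finsupp.single_eq_of_ne h.symm, add_zero, Finsupp.single_eq_same]
  by_cases hi : i = k
  · subst hi
    simp only [Finsupp.single_eq_same, Finsupp.single_eq_of_ne h]
    simp only [mul_add, sub_mul, neg_mul, one_mul, mul_neg, Units.mul_inv_cancel_left, add_zero]
    abel
  · by_cases hj : j = k
    · subst hj
      simp only [Finsupp.single_eq_same, Finsupp.single_eq_of_ne h.symm]
      simp only [mul_add, sub_mul, mul_sub, neg_mul, one_mul, mul_neg, Units.mul_inv_cancel_left,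
        Units.inv_mul_cancel_left, add_zero]
      abel
    · simp [Finsupp.single_eq_of_ne (Ne.symm hi), Finsupp.single_eq_of_ne (Ne.symm hj)]

/-- The generator `xᵢⱼ(a)` of the Steinberg group. -/
def St.x (i j : ℕ) (h : i ≠ j) (a : S) : St S := PresentedGroup.of ⟨i, j, h, a⟩

theorem St.toGL_x (i j : ℕ) (h : i ≠ j) (a : S) : St.toGL S (St.x i j h a) = elem i j h a :=
  St.toGL_of _

theorem St.x_mul (i j : ℕ) (h : i ≠ j) (a b : S) :
    St.x i j h a * St.x i j h b = St.x i j h (a + b) := by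
  have := St.mk_eq_one (SteinbergRel.add i j h a b)
  rw [map_mul, map_inv, mul_inv_eq_one] at this
  exact this

theorem St.x_zero (i j : ℕ) (h : i ≠ j) : St.x i j h (0 : S) = 1 := by
  have := St.x_mul i j h (0 : S) 0
  rwa [add_zero, mul_eq_left] at this

theorem St.x_comm (i j k : ℕ) (hij : i ≠ j) (hjk : j ≠ k) (hik : i ≠ k) (a b : S) :
    St.x i j hij a * St.x j k hjk b * (St.x i j hij a)⁻¹ * (St.x j k hjk b)⁻¹ =
      St.x i k hik (a * b) := by
  have := St.mk_eq_one (SteinbergRel.comm i j k hij hjk hik a b)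
  rw [commutatorElement_def, map_mul, map_inv, mul_inv_eq_one] at this
  exact this

theorem dilation_mul_dilation_inv_mem_range {i j : ℕ} (h : i ≠ j) (s : Sˣ) :
    dilation i s * dilation j s⁻¹ ∈ (St.toGL S).range := by
  rw [← elem_mul_eq_dilation h]
  simp only [← St.toGL_x, ← map_mul]
  exact ⟨_, rfl⟩

end Rings

/-! ### Relative elementary matrices and reduction to a single unit -/

section Relative

variable {S T : Type*} [Ring S] [Ring T] (f : S →+* T)

theorem St.map_x (i j : ℕ) (h : i ≠ j) (a : S) :
    St.map f (St.x i j h a) = St.x i j h (f a) := St.map_of f _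

theorem St.map_surjective (hf : Function.Surjective f) : Function.Surjective (St.map f) := by
  rw [← MonoidHom.range_eq_top, eq_top_iff, ← PresentedGroup.closure_range_of,
    Subgroup.closure_le]
  rintro _ ⟨⟨i, j, h, a⟩, rfl⟩
  obtain ⟨b, rfl⟩ := hf a
  exact ⟨St.x i j h b, St.map_x f i j h b⟩

/-- The image in `GL(S)` of the kernel of `St(S) → St(T)`: the relative elementary group. -/
noncomputable def relElem : Subgroup (StableGL S) := (St.map f).ker.map (St.toGL S)

variable {f}

theorem elem_mem_relElem {i j : ℕ} (h : i ≠ j) {a : S} (ha : f a = 0) :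
    elem i j h a ∈ relElem f :=
  ⟨St.x i j h a, by
    change St.map f _ = 1
    rw [St.map_x, ha, St.x_zero], St.toGL_x i j h a⟩

theorem conj_mem_relElem {u e : StableGL S} (hu : u ∈ relElem f) (he : e ∈ (St.toGL S).range) :
    e * u * e⁻¹ ∈ relElem f := by
  obtain ⟨x, hx, rfl⟩ := hu
  obtain ⟨y, rfl⟩ := he
  refine ⟨y * x * y⁻¹, (MonoidHom.normal_ker _).conj_mem x hx y, ?_⟩
  simp

theorem dilation_mul_dilation_inv_mem_relElem {i j : ℕ} (h : i ≠ j) {s : Sˣ} (hs : f s = 1) :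
    dilation i s * dilation j s⁻¹ ∈ relElem f := by
  have hs' : f (s⁻¹ : Sˣ) = 1 := by
    have := congrArg f s.inv_mul
    rwa [map_mul, hs, mul_one, map_one] at this
  -- The Whitehead word itself is the lift: when s maps to 1 it becomes x_ji(0) x_ij(1) x_ji(0)
  -- x_ij(-1) = 1 in St(T).
  refine ⟨St.x j i h.symm ((s⁻¹ : Sˣ) - 1 : S) * St.x i j h 1 * St.x j i h.symm ((s : S) - 1) *
      St.x i j h (-((s⁻¹ : Sˣ) : S)), ?_, ?_⟩
  · change St.map f _ = 1
    simp only [map_mul, St.map_x, map_sub, map_neg, hs, hs', map_one, sub_self, St.x_zero, one_mul,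
      mul_one, St.x_mul, add_neg_cancel]
  · rw [← elem_mul_eq_dilation h]
    simp only [← St.toGL_x, ← map_mul]

/-- Divide diag(w, w⁻¹, 1) by its conjugate under diag(g, 1, g⁻¹). The entries w⁻¹ in place 1
cancel, since the conjugating matrix is trivial there, and w (g w⁻¹ g⁻¹) remains in place 0. -/
theorem dilation_commutator_mem_relElem {w : Sˣ} (hw : f w = 1) (g : Sˣ) :
    dilation 0 (w * g * w⁻¹ * g⁻¹) ∈ relElem f := by
  have h1 : dilation 0 w * dilation 1 w⁻¹ ∈ relElem f :=
    dilation_mul_dilation_inv_mem_relElem (by omega) hw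
  have h2 := conj_mem_relElem h1
    (dilation_mul_dilation_inv_mem_range (show (0 : ℕ) ≠ 2 by omega) g)
  have h3 := mul_mem h1 (inv_mem h2)
  convert h3 using 1
  have c1 (s t : Sˣ) : Commute (dilation 0 s) (dilation 1 t) := dilation_comm (by omega) s t
  have c2 (s t : Sˣ) : Commute (dilation 0 s) (dilation 2 t) := dilation_comm (by omega) s t
  have c3 (s t : Sˣ) : Commute (dilation 1 s) (dilation 2 t) := dilation_comm (by omega) s t
  have e : dilation 0 g * dilation 2 g⁻¹ * (dilation 0 w * dilation 1 w⁻¹) *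
      (dilation 0 g * dilation 2 g⁻¹)⁻¹ = dilation 0 (g * w * g⁻¹) * dilation 1 w⁻¹ := by
    rw [mul_inv_eq_iff_eq_mul, mul_assoc (dilation 0 g), ← mul_assoc (dilation 2 g⁻¹),
      ← (c2 w g⁻¹).eq, mul_assoc (dilation 0 w), ← (c3 w⁻¹ g⁻¹).eq,
      mul_assoc (dilation 0 (g * w * g⁻¹)), ← mul_assoc (dilation 1 w⁻¹), ← (c1 g w⁻¹).eq,
      mul_assoc (dilation 0 g) (dilation 1 w⁻¹), ← mul_assoc, ← mul_assoc, dilation_mul,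
      mul_assoc, ← mul_assoc (dilation 0 (g * w * g⁻¹)), dilation_mul, inv_mul_cancel_right]
  rw [e, mul_inv_rev, mul_assoc (dilation 0 w), mul_inv_cancel_left, dilation_inv, dilation_mul]
  congr 1
  group

theorem exists_relElem_column (q : ℕ) (t : Finset ℕ) (hq : q ∉ t) (c : ℕ → S)
    (hc : ∀ i ∈ t, f (c i) = 0) :
    ∃ h ∈ relElem f, ∀ v : Col S,
      h.1.1 v = v + ∑ i ∈ t, Finsupp.single i (c i * v q) := by
  induction t using Finset.induction_on with
  | empty => exact ⟨1, one_mem _, fun v => by simp⟩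
  | insert a t ha ih =>
    rw [Finset.mem_insert, not_or] at hq
    obtain ⟨h, hh, hv⟩ := ih hq.2 fun i hi => hc i (Finset.mem_insert_of_mem hi)
    refine ⟨h * elem a q (Ne.symm hq.1) (c a),
      mul_mem hh (elem_mem_relElem _ (hc a (Finset.mem_insert_self _ _))), fun v => ?_⟩
    rw [StableGL.mul_apply, elem_apply, hv, Finset.sum_insert ha]
    simp only [Finsupp.add_apply, Finsupp.single_eq_of_ne hq.1, add_zero]
    abel

theorem exists_relElem_row (q : ℕ) (t : Finset ℕ) (hq : q ∉ t) (c : ℕ → S)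
    (hc : ∀ i ∈ t, f (c i) = 0) :
    ∃ h ∈ relElem f, ∀ v : Col S,
      h.1.1 v = v + Finsupp.single q (∑ i ∈ t, c i * v i) := by
  induction t using Finset.induction_on with
  | empty => exact ⟨1, one_mem _, fun v => by simp⟩
  | insert a t ha ih =>
    rw [Finset.mem_insert, not_or] at hq
    obtain ⟨h, hh, hv⟩ := ih hq.2 fun i hi => hc i (Finset.mem_insert_of_mem hi)
    refine ⟨elem q a hq.1 (c a) * h,
      mul_mem (elem_mem_relElem _ (hc a (Finset.mem_insert_self _ _))) hh, fun v => ?_⟩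
    rw [StableGL.mul_apply, elem_apply, hv, Finset.sum_insert ha, Finsupp.single_add]
    simp only [Finsupp.add_apply, Finsupp.single_eq_of_ne (Ne.symm hq.1), add_zero]
    abel

/-- `u` is the identity outside the block of the first `m` rows and columns. -/
def SupportedBelow (m : ℕ) (u : StableGL S) : Prop :=
  ∀ i ≥ m, u.1.1 (Finsupp.single i 1) = Finsupp.single i 1 ∧ ∀ v : Col S, u.1.1 v i = v i

theorem SupportedBelow.mul {m : ℕ} {u u' : StableGL S} (h : SupportedBelow m u)
    (h' : SupportedBelow m u') : SupportedBelow m (u * u') := fun i hi => by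
  refine ⟨?_, fun v => ?_⟩
  · rw [StableGL.mul_apply, (h' i hi).1, (h i hi).1]
  · rw [StableGL.mul_apply, (h i hi).2, (h' i hi).2]

theorem SupportedBelow.mono {m n : ℕ} (hmn : m ≤ n) {u : StableGL S} (h : SupportedBelow m u) :
    SupportedBelow n u := fun i hi => h i (hmn.trans hi)

theorem StableGL.apply_single (u : StableGL S) (i : ℕ) (a : S) :
    u.1.1 (Finsupp.single i a) = MulOpposite.op a • u.1.1 (Finsupp.single i 1) := by
  rw [← map_smul]; congr 1; simp

variable (f) in
/-- The congruence subgroup: the kernel of `GL(S) → GL(T)`. -/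
def congruenceSubgroup : Subgroup (StableGL S) where
  carrier := {u | ∀ v : Col S, (u.1.1 v).mapRange f (map_zero f) = v.mapRange f (map_zero f)}
  one_mem' := fun _ => rfl
  mul_mem' {a b} ha hb v := by
    change Finsupp.mapRange f (map_zero f) ((a * b).1.1 v) = _
    rw [StableGL.mul_apply, ha, hb]
  inv_mem' {a} ha v := by
    have h := ha (a⁻¹.1.1 v)
    rw [← StableGL.mul_apply, mul_inv_cancel] at h
    exact h.symm

theorem toGL_mem_congruenceSubgroup {x : St S} (hx : St.map f x ∈ K₂ T) :
    St.toGL S x ∈ congruenceSubgroup f := fun v => by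
  rw [← St.toGL_map, show St.toGL T (St.map f x) = 1 from hx]
  rfl

theorem relElem_le_congruenceSubgroup : relElem f ≤ congruenceSubgroup f := by
  rintro _ ⟨x, hx, rfl⟩
  refine toGL_mem_congruenceSubgroup ?_
  rw [show St.map f x = 1 from hx]
  exact one_mem _

theorem congruenceSubgroup_apply {u : StableGL S} (hu : u ∈ congruenceSubgroup f) (v : Col S)
    (i : ℕ) : f (u.1.1 v i) = f (v i) := by
  simpa using DFunLike.congr_fun (hu v) i

/-- One step of Gaussian elimination with relative elementary matrices. -/
theorem exists_supportedBelow_of_succ (hunit : ∀ s : S, f s = 1 → IsUnit s) {q : ℕ} (hq : q ≠ 0)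
    {u : StableGL S} (hu : u ∈ congruenceSubgroup f) (hs : SupportedBelow (q + 1) u) :
    ∃ h ∈ relElem f, ∃ h' ∈ relElem f, SupportedBelow q (h * u * h') := by
  obtain ⟨w, hw⟩ := hunit (u.1.1 (Finsupp.single q 1) q) (by
    rw [congruenceSubgroup_apply hu]; simp)
  have hfw : f w = 1 := by rw [hw, congruenceSubgroup_apply hu]; simp
  -- The pivot w is moved to place 0, so that the pivot at q becomes 1 without leaving the relative
  -- elementary group. This needs q ≠ 0.
  have hd : dilation 0 w * dilation q w⁻¹ ∈ relElem f :=
    dilation_mul_dilation_inv_mem_relElem (Ne.symm hq) hfw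
  set d := dilation 0 w * dilation q w⁻¹
  have hd1 : SupportedBelow (q + 1) d := fun i hi => by
    have h0 : i ≠ 0 := by omega
    have h1 : i ≠ q := by omega
    refine ⟨?_, fun v => ?_⟩ <;>
    simp [d, dilation_apply, Finsupp.single_eq_of_ne h0,
      Finsupp.single_eq_of_ne h1, Finsupp.single_eq_of_ne h0.symm, Finsupp.single_eq_of_ne h1.symm]
  set u1 := u * d with hu1
  have hs1 : SupportedBelow (q + 1) u1 := hs.mul hd1
  have hc1 : u1 ∈ congruenceSubgroup f := mul_mem hu (relElem_le_congruenceSubgroup hd)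
  have hp1 : u1.1.1 (Finsupp.single q 1) q = 1 := by
    have : d.1.1 (Finsupp.single q 1) = Finsupp.single q (w⁻¹ : Sˣ).1 := by
      simp only [d, StableGL.mul_apply, dilation_apply, Finsupp.single_eq_same,
        Finsupp.single_eq_of_ne (Ne.symm hq), mul_one, mul_zero, Finsupp.single_zero, add_zero,
        ← Finsupp.single_add]
      congr 1; abel
    rw [hu1, StableGL.mul_apply, this, StableGL.apply_single, Finsupp.smul_apply, ← hw]
    simp
  obtain ⟨h, hh, hv⟩ := exists_relElem_column (f := f) q (Finset.range q) (by simp)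
    (fun i => -u1.1.1 (Finsupp.single q 1) i) (fun i hi => by
      rw [map_neg, congruenceSubgroup_apply hc1,
        Finsupp.single_eq_of_ne (Finset.mem_range.1 hi).ne, map_zero, neg_zero])
  have hcol (v : Col S) (i : ℕ) : h.1.1 v i =
      v i + if i < q then -u1.1.1 (Finsupp.single q 1) i * v q else 0 := by
    rw [hv, Finsupp.add_apply, Finsupp.finsetSum_apply]
    simp only [Finsupp.single_apply, Finset.sum_ite_eq', Finset.mem_range]
  set u2 := h * u1 with hu2
  have hq2 : u2.1.1 (Finsupp.single q 1) = Finsupp.single q 1 := by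
    ext i
    rw [hu2, StableGL.mul_apply, hcol, hp1]
    rcases lt_trichotomy i q with hi | rfl | hi
    · simp [hi, Finsupp.single_eq_of_ne hi.ne]
    · simp [hp1]
    · rw [if_neg (by omega), (hs1 i hi).2, add_zero]
  have hs2 : SupportedBelow (q + 1) u2 := by
    refine SupportedBelow.mul (fun i hi => ⟨?_, fun v => ?_⟩) hs1
    · rw [hv]
      simp [Finsupp.single_eq_of_ne (show q ≠ i by omega)]
    · rw [hcol, if_neg (by omega), add_zero]
  have hc2 : u2 ∈ congruenceSubgroup f := mul_mem (relElem_le_congruenceSubgroup hh) hc1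
  obtain ⟨h', hh', hv'⟩ := exists_relElem_row (f := f) q (Finset.range q) (by simp)
    (fun i => -u2.1.1 (Finsupp.single i 1) q) (fun i hi => by
      rw [map_neg, congruenceSubgroup_apply hc2,
        Finsupp.single_eq_of_ne (Finset.mem_range.1 hi).ne', map_zero, neg_zero])
  -- Column q of `u2` is already standard, so the row operation `h'` has only to cancel the entries
  -- of row q to the left of the diagonal.
  have hrow (v : Col S) : u2.1.1 v q +
      ∑ i ∈ Finset.range q, -u2.1.1 (Finsupp.single i 1) q * v i = v q := by
    induction v using Finsupp.induction_linear with
    | zero => simp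
    | add v w hv hw =>
      rw [Finsupp.add_apply, ← hv, ← hw]
      simp only [map_add, Finsupp.add_apply, mul_add, Finset.sum_add_distrib]
      abel
    | single j a =>
      rw [StableGL.apply_single]
      rcases lt_trichotomy j q with hj | rfl | hj
      · rw [Finset.sum_eq_single_of_mem j (Finset.mem_range.2 hj)]
        · simp [Finsupp.single_eq_of_ne hj.ne']
        · intro i _ hij
          rw [Finsupp.single_eq_of_ne hij, mul_zero]
      · rw [hq2, Finset.sum_eq_zero]
        · simp
        · intro i hi
          rw [Finsupp.single_eq_of_ne (Finset.mem_range.1 hi).ne, mul_zero]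
      · rw [(hs2 j hj).1, Finset.sum_eq_zero]
        · simp [Finsupp.single_eq_of_ne hj.ne]
        · intro i hi
          rw [Finsupp.single_eq_of_ne (by have := Finset.mem_range.1 hi; omega), mul_zero]
  have key (v : Col S) : (u2 * h').1.1 v = u2.1.1 v +
      Finsupp.single q (∑ i ∈ Finset.range q, -u2.1.1 (Finsupp.single i 1) q * v i) := by
    rw [StableGL.mul_apply, hv', map_add, StableGL.apply_single _ q, hq2]
    simp
  refine ⟨h, hh, d * h', mul_mem hd hh', ?_⟩
  rw [show h * u * (d * h') = u2 * h' by rw [hu2, hu1]; group]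
  intro i hi
  refine ⟨?_, fun v => ?_⟩
  · rw [key, Finset.sum_eq_zero, Finsupp.single_zero, add_zero]
    · rcases hi.eq_or_lt with rfl | hi
      · exact hq2
      · exact (hs2 i hi).1
    · intro j hj
      rw [Finsupp.single_eq_of_ne (by have := Finset.mem_range.1 hj; omega), mul_zero]
  · rw [key, Finsupp.add_apply]
    rcases hi.eq_or_lt with rfl | hi
    · rw [Finsupp.single_eq_same, hrow]
    · rw [Finsupp.single_eq_of_ne hi.ne', add_zero, (hs2 i hi).2]

theorem exists_eq_dilation (hunit : ∀ s : S, f s = 1 → IsUnit s)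
    {u : StableGL S} (hu : u ∈ congruenceSubgroup f) :
    ∃ h ∈ relElem f, ∃ h' ∈ relElem f, ∃ s : Sˣ, f s = 1 ∧ h * u * h' = dilation 0 s := by
  have main : ∀ m : ℕ, ∀ u ∈ congruenceSubgroup f, SupportedBelow (m + 1) u →
      ∃ h ∈ relElem f, ∃ h' ∈ relElem f, SupportedBelow 1 (h * u * h') := by
    intro m
    induction m with
    | zero => exact fun u _ h => ⟨1, one_mem _, 1, one_mem _, by simpa using h⟩
    | succ m ih =>
      intro u hu hs
      obtain ⟨h, hh, h', hh', hb⟩ := exists_supportedBelow_of_succ hunit m.succ_ne_zero hu hs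
      obtain ⟨k, hk, k', hk', hb'⟩ := ih _ (mul_mem (mul_mem (relElem_le_congruenceSubgroup hh) hu)
        (relElem_le_congruenceSubgroup hh')) hb
      refine ⟨k * h, mul_mem hk hh, h' * k', mul_mem hh' hk', ?_⟩
      simpa only [mul_assoc] using hb'
  obtain ⟨m, hm⟩ : ∃ m, SupportedBelow m u := u.2
  obtain ⟨h, hh, h', hh', hb⟩ := main m u hu (hm.mono m.le_succ)
  have hc : h * u * h' ∈ congruenceSubgroup f := mul_mem
    (mul_mem (relElem_le_congruenceSubgroup hh) hu) (relElem_le_congruenceSubgroup hh')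
  obtain ⟨s, hs⟩ := hunit ((h * u * h').1.1 (Finsupp.single 0 1) 0) (by
    rw [congruenceSubgroup_apply hc]; simp)
  refine ⟨h, hh, h', hh', s, by rw [hs, congruenceSubgroup_apply hc]; simp, ?_⟩
  refine StableGL.ext fun v => ?_
  induction v using Finsupp.induction_linear with
  | zero => rw [map_zero, map_zero]
  | add v w hv hw => rw [map_add, map_add, hv, hw]
  | single i a =>
    rw [StableGL.apply_single, StableGL.apply_single (dilation 0 s)]
    congr 1
    ext j
    rw [dilation_apply]
    rcases Nat.eq_zero_or_pos i with rfl | hi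
    · rcases Nat.eq_zero_or_pos j with rfl | hj
      · rw [← hs]; simp
      · rw [(hb j hj).2]
        simp [Finsupp.single_eq_of_ne hj.ne']
    · rw [(hb i hi).1]
      simp [Finsupp.single_eq_of_ne hi.ne]

/-- A lift x of the given class is corrected by an element z of ker(St(S) → St(T)) having the same
matrix. Elimination reduces the existence of z to the case of a one-entry diagonal matrix, which is
`H`. -/
theorem K₂.map_surjective_of (hf : Function.Surjective f) (hunit : ∀ s : S, f s = 1 → IsUnit s)
    (H : ∀ s : Sˣ, f s = 1 → dilation 0 s ∈ (St.toGL S).range → dilation 0 s ∈ relElem f) :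
    Function.Surjective (K₂.map f) := by
  rintro ⟨y, hy⟩
  obtain ⟨x, rfl⟩ := St.map_surjective f hf y
  obtain ⟨h, hh, h', hh', s, hs, e⟩ :=
    exists_eq_dilation hunit (toGL_mem_congruenceSubgroup hy)
  have hle : relElem f ≤ (St.toGL S).range := Subgroup.map_le_range _ _
  have h1 : dilation 0 s ∈ relElem f :=
    H s hs (e ▸ mul_mem (mul_mem (hle hh) ⟨x, rfl⟩) (hle hh'))
  have h2 : St.toGL S x ∈ relElem f := by
    have : St.toGL S x = h⁻¹ * dilation 0 s * h'⁻¹ := by rw [← e]; group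
    rw [this]
    exact mul_mem (mul_mem (inv_mem hh) h1) (inv_mem hh')
  obtain ⟨z, hz, hzx⟩ := h2
  have hz' : St.map f z = 1 := hz
  refine ⟨⟨x * z⁻¹, ?_⟩, ?_⟩
  · change St.toGL S (x * z⁻¹) = 1
    rw [map_mul, map_inv, hzx, mul_inv_cancel]
  · refine Subtype.ext ?_
    change St.map f (x * z⁻¹) = St.map f x
    rw [map_mul, map_inv, hz', inv_one, mul_one]

end Relative

/-! ### Determinants of stable matrices through a matrix representation -/

section StableDet

open Filter

variable {S : Type*} [Ring S]

/-- The upper left `m × m` block of an infinite matrix. -/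
noncomputable def truncation (m : ℕ) (u : StableGL S) : Matrix (Fin m) (Fin m) S :=
  Matrix.of fun i j => u.1.1 (Finsupp.single (j : ℕ) 1) i

theorem truncation_apply (m : ℕ) (u : StableGL S) (i j : Fin m) :
    truncation m u i j = u.1.1 (Finsupp.single (j : ℕ) 1) i := rfl

theorem truncation_one (m : ℕ) : truncation m (1 : StableGL S) = 1 := by
  ext i j
  change (Finsupp.single (j : ℕ) (1 : S)) (i : ℕ) = _
  simp [Matrix.one_apply, Finsupp.single_apply, Fin.ext_iff, eq_comm]

/-- A condition on the right factor alone suffices: its first m columns vanish from row m on, so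
only indices below m enter the product. -/
theorem truncation_mul {m : ℕ} (u : StableGL S) {u' : StableGL S} (h : SupportedBelow m u') :
    truncation m (u * u') = truncation m u * truncation m u' := by
  ext i j
  simp only [Matrix.mul_apply, truncation_apply, StableGL.mul_apply]
  set w : Col S := u'.1.1 (Finsupp.single (j : ℕ) 1) with hw
  have hw' : w = ∑ k : Fin m, Finsupp.single (k : ℕ) (w k) := by
    ext k
    rw [Finsupp.finsetSum_apply]
    by_cases hk : k < m
    · rw [Finset.sum_eq_single (⟨k, hk⟩ : Fin m)]
      · simp
      · intro b _ hb
        rw [Finsupp.single_eq_of_ne]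
        rintro rfl
        exact hb rfl
      · simp
    · rw [hw, (h k (not_lt.1 hk)).2, Finsupp.single_eq_of_ne (by omega), Finset.sum_eq_zero]
      intro b _
      rw [Finsupp.single_eq_of_ne (by omega)]
  conv_lhs => rw [hw', map_sum, Finsupp.finsetSum_apply]
  refine Finset.sum_congr rfl fun k _ => ?_
  rw [StableGL.apply_single]
  rfl

variable {κ B : Type*} [Fintype κ] [DecidableEq κ] [CommRing B] (ρ : S →+* Matrix κ κ B)

/-- The determinant of a matrix over `S`, seen through a matrix representation of `S`. -/
noncomputable def repDet (m : ℕ) : Matrix (Fin m) (Fin m) S →* B :=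
  (Matrix.detMonoidHom (n := Fin m × κ) (R := B)).comp
    (((Matrix.compRingEquiv (Fin m) κ B).toRingHom.comp ρ.mapMatrix : _ →+* _) : _ →* _)

theorem repDet_diagonal (m : ℕ) (d : Fin m → S) :
    repDet ρ m (Matrix.diagonal d) = ∏ i, (ρ (d i)).det := by
  rw [← Matrix.det_blockDiagonal, ← Matrix.det_submatrix_equiv_self (Equiv.prodComm (Fin m) κ)]
  change Matrix.det _ = _
  congr 1
  ext ⟨i, k⟩ ⟨j, l⟩
  change ρ (Matrix.diagonal d i j) k l = if i = j then _ else _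
  by_cases h : i = j
  · subst h; simp
  · simp [h]

/-- The determinant of a stable matrix over `S`, seen through a matrix representation of `S`, as
the common value of the determinants of all sufficiently large blocks. -/
noncomputable def stableDet : StableGL S →* Germ (atTop : Filter ℕ) B where
  toFun u := ((fun m => repDet ρ m (truncation m u) : ℕ → B) : Germ (atTop : Filter ℕ) B)
  map_one' := by
    simp only [truncation_one, map_one]
    rfl
  map_mul' u u' := by
    rw [← Germ.coe_mul]
    refine Germ.coe_eq.2 ?_
    obtain ⟨m, hm⟩ : ∃ m, SupportedBelow m u' := u'.2
    filter_upwards [eventually_ge_atTop m] with k hk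
    rw [truncation_mul u (hm.mono hk), map_mul]
    rfl

/-- Germs of B-valued sequences form a commutative monoid, while every Steinberg generator is a
commutator. -/
theorem stableDet_toGL (x : St S) : stableDet ρ (St.toGL S x) = 1 := by
  let D : St S →* (Germ (atTop : Filter ℕ) B)ˣ := ((stableDet ρ).comp (St.toGL S)).toHomUnits
  have hD : D = 1 := by
    refine PresentedGroup.ext ?_
    rintro ⟨i, j, h, a⟩
    change D (St.x i j h a) = 1
    -- The index i + j + 1 differs from both i and j, so x_ij(a) = [x_ik(a), x_kj(1)] with k = i + j
    -- + 1.
    have hik : i ≠ i + j + 1 := by omega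
    have hkj : i + j + 1 ≠ j := by omega
    rw [← mul_one a, ← St.x_comm i (i + j + 1) j hik hkj h]
    simp
  have := congrArg Units.val (DFunLike.congr_fun hD x)
  exact this

theorem stableDet_dilation (s : Sˣ) :
    stableDet ρ (dilation 0 s) = ((ρ s).det : Germ (atTop : Filter ℕ) B) := by
  refine Germ.coe_eq.2 ?_
  filter_upwards [eventually_gt_atTop 0] with m hm
  have : truncation m (dilation 0 s) =
      Matrix.diagonal fun i : Fin m => if (i : ℕ) = 0 then (s : S) else 1 := by
    ext i j
    rw [truncation_apply, dilation_apply, Matrix.diagonal_apply, Finsupp.add_apply]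
    by_cases hi : (i : ℕ) = 0 <;> by_cases hj : (j : ℕ) = 0 <;>
      simp [hi, hj, Finsupp.single_apply, Fin.ext_iff, eq_comm]
  rw [this, repDet_diagonal, Finset.prod_eq_single_of_mem (⟨0, hm⟩ : Fin m) (Finset.mem_univ _)]
  · simp
  · intro b _ hb
    rw [if_neg fun h => hb (Fin.ext h), map_one, Matrix.det_one]

theorem det_eq_one_of_dilation_mem_range {s : Sˣ} (h : dilation 0 s ∈ (St.toGL S).range) :
    (ρ s).det = 1 := by
  obtain ⟨x, hx⟩ := h
  have := stableDet_toGL ρ x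
  rw [hx, stableDet_dilation] at this
  exact Germ.const_inj.1 this

end StableDet

/-! ### Powers of units congruent to 1 -/

section Multiples

variable {R A : Type*} [CommRing R] [Ring A] [Algebra R A]

variable (A) in
/-- The multiples of the scalar `q` in an `R`-algebra `A`. -/
def multiples (q : R) : Submodule R A := LinearMap.range (LinearMap.lsmul R A q)

theorem mem_multiples {q : R} {x : A} : x ∈ multiples A q ↔ ∃ c : A, q • c = x := Iff.rfl

theorem smul_mem_multiples (q : R) (x : A) : q • x ∈ multiples A q := ⟨x, rfl⟩

theorem multiples_le_of_dvd {q r : R} (h : q ∣ r) : multiples A r ≤ multiples A q := by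
  obtain ⟨s, rfl⟩ := h
  rintro _ ⟨c, rfl⟩
  exact ⟨s • c, smul_smul _ _ _⟩

theorem mul_mem_multiples_left {q : R} (a : A) {x : A} (h : x ∈ multiples A q) :
    a * x ∈ multiples A q := by
  obtain ⟨c, rfl⟩ := h
  exact ⟨a * c, (mul_smul_comm _ _ _).symm⟩

theorem mul_mem_multiples_right {q : R} (a : A) {x : A} (h : x ∈ multiples A q) :
    x * a ∈ multiples A q := by
  obtain ⟨c, rfl⟩ := h
  exact ⟨c * a, (smul_mul_assoc _ _ _).symm⟩

theorem mul_mem_multiples {q r : R} {x y : A} (hx : x ∈ multiples A q) (hy : y ∈ multiples A r) :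
    x * y ∈ multiples A (q * r) := by
  obtain ⟨c, rfl⟩ := hx
  obtain ⟨d, rfl⟩ := hy
  exact ⟨c * d, (smul_mul_smul_comm _ _ _ _).symm⟩

theorem pow_mem_multiples {q : R} {x : A} (hx : x ∈ multiples A q) (k : ℕ) :
    x ^ k ∈ multiples A (q ^ k) := by
  obtain ⟨c, rfl⟩ := hx
  exact ⟨c ^ k, (smul_pow _ _ _).symm⟩

/-- This controls the last binomial term x^p below. It fails for p = 2, N = 1, where (1 + 2y)² = 1 +
4(y + y²) has a first-order term different from y. -/
theorem add_two_le_mul {p N : ℕ} (hp : p.Prime) (hN : 2 < p ^ N) : N + 2 ≤ N * p := by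
  have hN0 : N ≠ 0 := by rintro rfl; simp at hN
  rcases hp.two_le.eq_or_lt with rfl | h
  · have : N ≠ 1 := by rintro rfl; simp at hN
    omega
  · have : 1 ≤ N := by omega
    nlinarith

/-- The `p`-th power of an element which is congruent to `1` modulo `p ^ N > 2`. -/
theorem exists_one_add_pow_prime {p N : ℕ} (hp : p.Prime) (hN : 2 < p ^ N) (y : A) :
    ∃ z : A, (1 + (p : R) ^ N • y) ^ p = 1 + (p : R) ^ (N + 1) • (y + (p : R) • z) := by
  have hN0 : 1 ≤ N := by
    rcases N with _ | N
    · simp at hN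
    · omega
  set x : A := (p : R) ^ N • y with hx
  have hxm : x ∈ multiples A ((p : R) ^ N) := smul_mem_multiples _ _
  suffices h : (1 + x) ^ p - (1 + (p : R) • x) ∈ multiples A ((p : R) ^ (N + 2)) by
    obtain ⟨z, hz⟩ := mem_multiples.1 h
    refine ⟨z, ?_⟩
    rw [eq_comm, sub_eq_iff_eq_add'] at hz
    rw [hz, hx, smul_add, smul_smul, smul_smul, add_assoc]
    congr 3
    · rw [pow_succ']
    · rw [← pow_succ]
  obtain ⟨k, rfl⟩ : ∃ k, p = k + 2 := ⟨p - 2, by have := hp.two_le; omega⟩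
  rw [add_comm (1 : A), (Commute.one_right x).add_pow, Finset.sum_range_succ',
    Finset.sum_range_succ']
  have e : ∀ s : A, s + x ^ (0 + 1) * 1 ^ (k + 2 - (0 + 1)) * ((k + 2).choose (0 + 1) : ℕ) +
      x ^ 0 * 1 ^ (k + 2 - 0) * ((k + 2).choose 0 : ℕ) - (1 + ((k + 2 : ℕ) : R) • x) = s := by
    intro s
    simp only [zero_add, Nat.choose_one_right, Nat.choose_zero_right, pow_one, one_pow, mul_one,
      pow_zero, Nat.cast_one]
    rw [Nat.cast_smul_eq_nsmul, nsmul_eq_mul, (Nat.cast_commute (k + 2) x).eq]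
    abel
  rw [e]
  refine Submodule.sum_mem _ fun i hi => ?_
  rw [one_pow, mul_one, add_assoc]
  rw [Finset.mem_range] at hi
  have hxi := pow_mem_multiples hxm (i + 2)
  rw [← pow_mul] at hxi
  -- The term x^p lies in p^(Np), hence in p^(N+2). In each intermediate term x^j, 2 ≤ j < p, the
  -- binomial coefficient supplies one more factor p, and jN + 1 ≥ N + 2.
  rcases (show i ≤ k by omega).eq_or_lt with rfl | hi
  · exact mul_mem_multiples_right _ (multiples_le_of_dvd (pow_dvd_pow _ (add_two_le_mul hp hN)) hxi)
  · obtain ⟨c, hc⟩ : (k + 2) ∣ (k + 2).choose (i + 2) :=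
      hp.dvd_choose_self (by omega) (by omega)
    have h1 : (((k + 2).choose (i + 2) : ℕ) : A) ∈ multiples A ((k + 2 : ℕ) : R) := by
      refine ⟨(c : A), ?_⟩
      rw [LinearMap.lsmul_apply, Nat.cast_smul_eq_nsmul, nsmul_eq_mul, ← Nat.cast_mul, ← hc]
    refine multiples_le_of_dvd ?_ (mul_mem_multiples hxi h1)
    rw [← pow_succ]
    exact pow_dvd_pow _ (by nlinarith)

theorem exists_one_add_pow_prime_pow {p N : ℕ} (hp : p.Prime) (hN : 2 < p ^ N) (y : A) (m : ℕ) :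
    ∃ z : A, (1 + (p : R) ^ N • y) ^ p ^ m = 1 + (p : R) ^ (N + m) • (y + (p : R) • z) := by
  induction m with
  | zero => exact ⟨0, by simp⟩
  | succ m ih =>
    obtain ⟨z, hz⟩ := ih
    have hN' : 2 < p ^ (N + m) := hN.trans_le (Nat.pow_le_pow_right hp.pos (Nat.le_add_right _ _))
    obtain ⟨z', hz'⟩ := exists_one_add_pow_prime (R := R) hp hN' (y + (p : R) • z)
    refine ⟨z + z', ?_⟩
    rw [pow_succ, pow_mul, hz, hz', smul_add (p : R) z z', ← add_assoc, ← add_assoc]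

end Multiples

/-! ### Left multiplication on R[G] over the group algebra of a subgroup -/

section Induction

open scoped IsMulCommutative

variable {R : Type*} [CommRing R] {G : Type*} [Group G] (C : Subgroup G)

/-- The action of `h` on the coset `q` of `C`, in terms of the chosen representatives. -/
noncomputable def cosetCocycle (h : G) (q : G ⧸ C) : C :=
  ⟨(h • q).out⁻¹ * (h * q.out), QuotientGroup.eq.1 (by
    rw [QuotientGroup.out_eq', ← smul_eq_mul, ← MulAction.Quotient.smul_coe,
      QuotientGroup.out_eq'])⟩

theorem cosetCocycle_mul (h k : G) (q : G ⧸ C) :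
    cosetCocycle C (h * k) q = cosetCocycle C h (k • q) * cosetCocycle C k q := by
  ext
  simp only [cosetCocycle, mul_smul, Subgroup.coe_mul]
  group

-- Another representative of the coset differs by an element of the commutative group C, which does
-- not move g under conjugation.
variable {C} in
theorem out_conj_eq_iff [IsMulCommutative C] {g : C} (h t : G) :
    ((t : G ⧸ C).out)⁻¹ * (h * (t : G ⧸ C).out) = g ↔ t⁻¹ * (h * t) = g := by
  obtain ⟨c, hc⟩ : ∃ c : C, (t : G ⧸ C).out = t * c := by
    refine ⟨⟨t⁻¹ * (t : G ⧸ C).out, QuotientGroup.eq.1 (QuotientGroup.out_eq' _).symm⟩, ?_⟩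
    simp
  have hcg : (c : G) * g = g * c := congrArg Subtype.val (mul_comm c g)
  rw [hc, mul_inv_rev, show (c : G)⁻¹ * t⁻¹ * (h * (t * c)) = (c : G)⁻¹ * (t⁻¹ * (h * t) * c) by
    group, inv_mul_eq_iff_eq_mul, hcg, mul_left_inj]

-- If h = kgk⁻¹, translation of the cosets by k carries those counted for g to those counted for h.
variable {C} in
theorem card_conj_eq [IsMulCommutative C] {g : C} {h : G} (hc : IsConj (g : G) h) :
    Nat.card {q : G ⧸ C // q.out⁻¹ * (h * q.out) = g} =
      Nat.card {q : G ⧸ C // q.out⁻¹ * (g * q.out) = (g : G)} := by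
  obtain ⟨k, rfl⟩ := isConj_iff.1 hc
  refine Nat.card_congr ((MulAction.toPerm k : Equiv.Perm (G ⧸ C)).subtypeEquiv fun q => ?_).symm
  obtain ⟨t, rfl⟩ := QuotientGroup.mk_surjective q
  change _ ↔ ((k * t : G) : G ⧸ C).out⁻¹ * (_ * ((k * t : G) : G ⧸ C).out) = _
  rw [out_conj_eq_iff, out_conj_eq_iff]
  refine Eq.congr_left ?_
  group

variable {C} in
theorem card_conj_eq_zero {g : C} {h : G} (hc : ¬ IsConj (g : G) h) :
    Nat.card {q : G ⧸ C // q.out⁻¹ * (h * q.out) = g} = 0 := by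
  refine Nat.card_eq_zero.2 (Or.inl ⟨fun ⟨q, hq⟩ => hc ?_⟩)
  refine isConj_iff.2 ⟨q.out, ?_⟩
  rw [← hq]
  group

variable {C} in
theorem card_conj_self_ne_zero [Finite (G ⧸ C)] [IsMulCommutative C] (g : C) :
    Nat.card {q : G ⧸ C // q.out⁻¹ * (g * q.out) = (g : G)} ≠ 0 := by
  refine Nat.card_ne_zero.2 ⟨⟨⟨((1 : G) : G ⧸ C), ?_⟩⟩, inferInstance⟩
  rw [out_conj_eq_iff]
  simp

variable [Fintype (G ⧸ C)] [DecidableEq (G ⧸ C)]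

variable (R) in
/-- The matrices of the left multiplications on the free right `R[C]`-module `R[G]`. -/
noncomputable def inducedHom : G →* Matrix (G ⧸ C) (G ⧸ C) (MonoidAlgebra R C) where
  toFun h := Matrix.of fun q' q =>
    if q' = h • q then MonoidAlgebra.single (cosetCocycle C h q) 1 else 0
  map_one' := by
    ext1 q' q
    have : cosetCocycle C 1 q = 1 := by ext; simp [cosetCocycle]
    simp [Matrix.one_apply, this, MonoidAlgebra.one_def]
  map_mul' h k := by
    ext1 q' q
    rw [Matrix.mul_apply, Finset.sum_eq_single (k • q)]
    · by_cases hq : q' = (h * k) • q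
      · simp [hq, mul_smul, cosetCocycle_mul, MonoidAlgebra.single_mul_single]
      · have : q' ≠ h • k • q := by rwa [← mul_smul]
        simp [hq, this]
    · intro t _ ht
      simp [ht]
    · simp

theorem inducedHom_apply (h : G) (q' q : G ⧸ C) : inducedHom R C h q' q =
    if q' = h • q then MonoidAlgebra.single (cosetCocycle C h q) 1 else 0 := rfl

variable (R) in
/-- The representation of `R[G]` by left multiplications on the free right `R[C]`-module `R[G]`. -/
noncomputable def inducedRep :
    MonoidAlgebra R G →ₐ[R] Matrix (G ⧸ C) (G ⧸ C) (MonoidAlgebra R C) :=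
  MonoidAlgebra.lift R _ G (inducedHom R C)

theorem inducedRep_single (h : G) (r : R) :
    inducedRep R C (MonoidAlgebra.single h r) = r • inducedHom R C h :=
  MonoidAlgebra.lift_single _ _ _

variable {C} in
theorem coeff_trace_inducedHom (g : C) (h : G) :
    (inducedHom R C h).trace.coeff g =
      (Nat.card {q : G ⧸ C // q.out⁻¹ * (h * q.out) = g} : R) := by
  classical
  have hq (q : G ⧸ C) : (inducedHom R C h q q).coeff g =
      if q.out⁻¹ * (h * q.out) = g then 1 else 0 := by
    rw [inducedHom_apply]
    by_cases h1 : q = h • q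
    · rw [if_pos h1, MonoidAlgebra.coeff_single, Finsupp.single_apply]
      refine if_congr ?_ rfl rfl
      rw [Subtype.ext_iff]
      simp only [cosetCocycle, ← h1]
    · rw [if_neg h1, if_neg]
      · rfl
      · intro h2
        refine h1 ?_
        conv_rhs => rw [← QuotientGroup.out_eq' q]
        conv_lhs => rw [← QuotientGroup.out_eq' q]
        exact QuotientGroup.eq.2 (h2 ▸ g.2)
  rw [Matrix.trace, MonoidAlgebra.coeff_sum, Finsupp.finsetSum_apply]
  simp only [Matrix.diag_apply, hq]
  rw [Finset.sum_boole, Nat.card_eq_fintype_card, Fintype.card_subtype]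

end Induction

/-! ### Divisibility of class sums -/

section ClassSum

open scoped IsMulCommutative

variable {R : Type*} [CommRing R] {G : Type*} [Group G] [Fintype G]

open Classical in
/-- The sum of the coefficients over the conjugacy class of `g`. -/
noncomputable def classSum (g : G) : MonoidAlgebra R G →+ R where
  toFun x := ∑ h with IsConj g h, x.coeff h
  map_zero' := by simp
  map_add' x y := by simp [Finset.sum_add_distrib]

open Classical in
theorem classSum_apply (g : G) (x : MonoidAlgebra R G) :
    classSum g x = ∑ h with IsConj g h, x.coeff h := rfl

theorem classSum_smul (g : G) (r : R) (x : MonoidAlgebra R G) :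
    classSum g (r • x) = r * classSum g x := by
  simp [classSum_apply, Finset.mul_sum]

open Classical in
theorem classSum_single (g h : G) (r : R) :
    classSum g (MonoidAlgebra.single h r) = if IsConj g h then r else 0 := by
  simp [classSum_apply, Finsupp.single_apply, Finset.sum_ite_eq]

/-- Only conjugates of g contribute to the trace at g, and they all contribute with the same
multiplicity. Thus the trace detects the class sum up to a nonzero integer. -/
theorem coeff_trace_inducedRep {C : Subgroup G} [Fintype (G ⧸ C)] [DecidableEq (G ⧸ C)]
    [IsMulCommutative C] [DecidableEq G] (g : C) (x : MonoidAlgebra R G) :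
    (inducedRep R C x).trace.coeff g =
      Nat.card {q : G ⧸ C // q.out⁻¹ * (g * q.out) = (g : G)} * classSum (g : G) x := by
  induction x using MonoidAlgebra.induction_linear with
  | zero => simp
  | add x y hx hy =>
    rw [map_add, Matrix.trace_add, MonoidAlgebra.coeff_add, Finsupp.add_apply, hx, hy, map_add,
      mul_add]
  | single h r =>
    rw [inducedRep_single, Matrix.trace_smul, MonoidAlgebra.coeff_smul_apply,
      coeff_trace_inducedHom, classSum_single, smul_eq_mul]
    by_cases hc : IsConj (g : G) h
    · rw [if_pos hc, card_conj_eq hc, mul_comm]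
    · rw [if_neg hc, card_conj_eq_zero hc, Nat.cast_zero, mul_zero, mul_zero]

/-- From det(1 + rM) = 1 + r tr M + r²e one gets r (tr M + r e) = 0. The group algebra may have zero
divisors, so r is cancelled coefficient by coefficient in the domain R. -/
theorem exists_trace_eq_smul [IsDomain R] {H κ : Type*} [CommMonoid H] [Fintype κ] [DecidableEq κ]
    {r : R} (hr : r ≠ 0) {M : Matrix κ κ (MonoidAlgebra R H)} (hM : (1 + r • M).det = 1) :
    ∃ b : MonoidAlgebra R H, M.trace = r • b := by
  have hM' : r • M = (algebraMap R (MonoidAlgebra R H) r) • M := (algebraMap_smul _ r M).symm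
  obtain ⟨e, he⟩ : ∃ e, (1 + algebraMap R (MonoidAlgebra R H) r • M).det = 1 +
      M.trace * algebraMap R (MonoidAlgebra R H) r + e * algebraMap R (MonoidAlgebra R H) r ^ 2 :=
    ⟨_, Matrix.det_one_add_smul _ M⟩
  rw [hM', he, add_assoc, add_eq_left] at hM
  refine ⟨-e, ?_⟩
  have h0 : r • (M.trace - r • -e) = 0 := by
    rw [← hM]
    simp only [Algebra.smul_def]
    ring
  have : M.trace - r • -e = 0 := by
    ext h
    have h1 : r * (M.trace - r • -e).coeff h = 0 :=
      congrArg (fun x : MonoidAlgebra R H => x.coeff h) h0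
    exact (mul_eq_zero.1 h1).resolve_left hr
  exact sub_eq_zero.1 this

/-- The multiplicity of the class sum in the trace is p^e c with p ∤ c. The power p^e of 1 + p^N y
is 1 + p^(N+e) (y + p z) and still has determinant 1, so p^(N+e) divides p^e c times the class sum
of y + p z. Cancel p^e, use N ≥ 1, and discard c by coprimality. -/
theorem dvd_classSum [IsDomain R] [CharZero R] {p N : ℕ} (hp : p.Prime) (hN : 2 < p ^ N)
    (y : MonoidAlgebra R G) (g : G) [Fintype (G ⧸ Subgroup.zpowers g)]
    [DecidableEq (G ⧸ Subgroup.zpowers g)]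
    (hy : (inducedRep R (Subgroup.zpowers g) (1 + (p : R) ^ N • y)).det = 1) :
    (p : R) ∣ classSum g y := by
  classical
  have hp0 : (p : R) ≠ 0 := Nat.cast_ne_zero.2 hp.ne_zero
  have hN0 : N ≠ 0 := by rintro rfl; simp at hN
  let g' : Subgroup.zpowers g := ⟨g, Subgroup.mem_zpowers g⟩
  obtain ⟨e, c, hc, hec⟩ := Nat.exists_eq_pow_mul_and_not_dvd (card_conj_self_ne_zero g') p
    hp.ne_one
  obtain ⟨z, hz⟩ := exists_one_add_pow_prime_pow (R := R) hp hN y e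
  have hdet : (1 + (p : R) ^ (N + e) •
      inducedRep R (Subgroup.zpowers g) (y + (p : R) • z)).det = 1 := by
    rw [← map_smul, ← map_one (inducedRep R (Subgroup.zpowers g)), ← map_add, ← hz, map_pow,
      Matrix.det_pow, hy, one_pow]
  obtain ⟨b, hb⟩ := exists_trace_eq_smul (pow_ne_zero _ hp0) hdet
  have h1 := coeff_trace_inducedRep g' (y + (p : R) • z)
  rw [hb, hec, MonoidAlgebra.coeff_smul_apply, smul_eq_mul, Nat.cast_mul, Nat.cast_pow,
    add_comm N e, pow_add, mul_assoc, mul_assoc] at h1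
  have h2 := mul_left_cancel₀ (pow_ne_zero e hp0) h1
  have h3 : (p : R) ∣ (c : R) * classSum g (y + (p : R) • z) :=
    h2 ▸ (dvd_pow_self _ hN0).mul_right _
  have h4 : IsCoprime (p : R) (c : R) := ((hp.coprime_iff_not_dvd).2 hc).cast
  have h5 := h4.dvd_of_dvd_mul_left h3
  rw [map_add, classSum_smul] at h5
  exact (dvd_add_left (dvd_mul_right _ _)).1 h5

end ClassSum

/-! ### First-order expansions of commutators and products -/

section Perturbation

variable {R A : Type*} [CommRing R] [Ring A] [Algebra R A]

theorem inv_sub_one_mem_multiples {q : R} {w : Aˣ} (hw : (w : A) - 1 ∈ multiples A q) :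
    ((w⁻¹ : Aˣ) : A) - 1 ∈ multiples A q := by
  have : ((w⁻¹ : Aˣ) : A) - 1 = -((w⁻¹ : Aˣ) * ((w : A) - 1)) := by
    rw [mul_sub, Units.inv_mul, mul_one, neg_sub]
  rw [this]
  exact neg_mem (mul_mem_multiples_left _ hw)

theorem commutator_sub_one_mem_multiples {q : R} {w : Aˣ} (hw : (w : A) - 1 ∈ multiples A q)
    (g : Aˣ) : ((w * g * w⁻¹ * g⁻¹ : Aˣ) : A) - 1 ∈ multiples A q := by
  have : ((w * g * w⁻¹ * g⁻¹ : Aˣ) : A) - 1 =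
      ((w : A) - 1) * (g * (w⁻¹ : Aˣ) * (g⁻¹ : Aˣ)) +
        g * ((((w⁻¹ : Aˣ) : A) - 1) * (g⁻¹ : Aˣ)) := by
    simp only [Units.val_mul, sub_mul, mul_sub, mul_assoc, one_mul, Units.mul_inv]
    abel
  rw [this]
  exact add_mem (mul_mem_multiples_right _ hw)
    (mul_mem_multiples_left _ (mul_mem_multiples_right _ (inv_sub_one_mem_multiples hw)))

/-- First order expansion of the commutator of `w` and `g` in `w`. -/
theorem commutator_sub_mem_multiples {q π : R} {w w' : Aˣ} {a : A}
    (hw : (w : A) - 1 ∈ multiples A q) (hw' : (w' : A) - 1 ∈ multiples A q)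
    (h : (w' : A) = w + π • a) (g : Aˣ) :
    ((w' * g * w'⁻¹ * g⁻¹ : Aˣ) : A) - (w * g * w⁻¹ * g⁻¹ : Aˣ) -
      π • (a - g * a * (g⁻¹ : Aˣ)) ∈ multiples A (π * q) := by
  set b : A := ((w'⁻¹ : Aˣ) : A) with hb
  set c : A := ((w⁻¹ : Aˣ) : A) with hc
  set d : A := ((g⁻¹ : Aˣ) : A) with hd
  -- The resolvent identity w'⁻¹ = w⁻¹ - π w'⁻¹ a w⁻¹.
  have hbc : b = c - π • (b * a * c) := by
    have h1 : b * w' * c = b * w * c + π • (b * a * c) := by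
      rw [h, mul_add, add_mul, mul_smul_comm, smul_mul_assoc]
    rw [Units.inv_mul, one_mul, mul_assoc b, Units.mul_inv, mul_one] at h1
    exact eq_sub_of_add_eq h1.symm
  have hgd : (g : A) * d = 1 := Units.mul_inv g
  have hb1 : b - 1 ∈ multiples A q := inv_sub_one_mem_multiples hw'
  have hc1 : c - 1 ∈ multiples A q := inv_sub_one_mem_multiples hw
  -- The remainder is π times a sum in which every term contains b - 1, w - 1 or c - 1, each a
  -- multiple of q.
  have key : ((w' * g * w'⁻¹ * g⁻¹ : Aˣ) : A) - (w * g * w⁻¹ * g⁻¹ : Aˣ) -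
      π • (a - g * a * d) = π • (a * g * (b - 1) * d - ((w : A) - 1) * (g * b * a * c * d) -
        g * ((b - 1) * (a * c * d)) - g * a * (c - 1) * d) := by
    have e1 : ((w' * g * w'⁻¹ * g⁻¹ : Aˣ) : A) =
        w * g * b * d + π • (a * g * b * d) := by
      simp only [Units.val_mul, h, ← hb, ← hd, add_mul, smul_mul_assoc]
    have e2 : (w : A) * g * b * d = w * g * c * d - π • (w * g * (b * a * c) * d) := by
      conv_lhs => rw [hbc]
      rw [mul_sub, sub_mul, mul_smul_comm, smul_mul_assoc]
    have e3 : ((w * g * w⁻¹ * g⁻¹ : Aˣ) : A) = w * g * c * d := rfl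
    have e4 : a * g * (b - 1) * d = a * g * b * d - a := by
      rw [mul_sub, sub_mul, mul_one, mul_assoc a g d, hgd, mul_one]
    rw [e1, e2, e3, e4]
    simp only [smul_sub, mul_sub, sub_mul, one_mul, mul_one, mul_assoc]
    abel
  rw [key]
  have hE : a * g * (b - 1) * d - ((w : A) - 1) * (g * b * a * c * d) -
      g * ((b - 1) * (a * c * d)) - g * a * (c - 1) * d ∈ multiples A q :=
    sub_mem (sub_mem (sub_mem
      (mul_mem_multiples_right _ (mul_mem_multiples_left _ hb1))
      (mul_mem_multiples_right _ hw))
      (mul_mem_multiples_left _ (mul_mem_multiples_right _ hb1)))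
      (mul_mem_multiples_right _ (mul_mem_multiples_left _ hc1))
  obtain ⟨e, he⟩ := mem_multiples.1 hE
  rw [← he, smul_smul]
  exact smul_mem_multiples _ _

theorem list_prod_sub_one_mem_multiples {ι : Type*} {q : R} (F : ι → Aˣ)
    (hF : ∀ i, (F i : A) - 1 ∈ multiples A q) (l : List ι) :
    (((l.map F).prod : Aˣ) : A) - 1 ∈ multiples A q := by
  induction l with
  | nil => simp
  | cons i l ih =>
    rw [List.map_cons, List.prod_cons, Units.val_mul]
    have : (F i : A) * ((l.map F).prod : Aˣ) - 1 =
        ((F i : A) - 1) * ((l.map F).prod : Aˣ) + ((((l.map F).prod : Aˣ) : A) - 1) := by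
      noncomm_ring
    rw [this]
    exact add_mem (mul_mem_multiples_right _ (hF i)) ih

/-- All factors are 1 modulo q, so first-order variations π ℓ of the factors simply add up in the
product, with an error in π q. -/
theorem list_prod_sub_mem_multiples {ι : Type*} {q π : R} (F F' : ι → Aˣ) (ℓ : ι → A)
    (hF : ∀ i, (F i : A) - 1 ∈ multiples A q) (hF' : ∀ i, (F' i : A) - 1 ∈ multiples A q)
    (h : ∀ i, (F' i : A) - F i - π • ℓ i ∈ multiples A (π * q)) (l : List ι) :
    (((l.map F').prod : Aˣ) : A) - ((l.map F).prod : Aˣ) - π • (l.map ℓ).sum ∈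
      multiples A (π * q) := by
  induction l with
  | nil => simp
  | cons i l ih =>
    simp only [List.map_cons, List.prod_cons, List.sum_cons, Units.val_mul]
    have h1 := list_prod_sub_one_mem_multiples F hF l
    generalize (((l.map F').prod : Aˣ) : A) = P' at *
    generalize (((l.map F).prod : Aˣ) : A) = P at *
    generalize (l.map ℓ).sum = s at *
    have : (F' i : A) * P' - F i * P - π • (ℓ i + s) =
        F' i * (P' - P - π • s) + ((F' i : A) - F i - π • ℓ i) * P +
          π • (((F' i : A) - 1) * s + ℓ i * (P - 1)) := by
      simp only [smul_add, smul_sub, mul_sub, sub_mul, mul_smul_comm, smul_mul_assoc, one_mul,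
        mul_one]
      abel
    rw [this]
    refine add_mem (add_mem (mul_mem_multiples_left _ ih) (mul_mem_multiples_right _ (h i))) ?_
    obtain ⟨e, he⟩ := mem_multiples.1
      (add_mem (mul_mem_multiples_right s (hF' i)) (mul_mem_multiples_left (ℓ i) h1))
    rw [← he, smul_smul]
    exact smul_mem_multiples _ _

end Perturbation

/-! ### Limits and units over a complete ring -/

section Complete

variable {R : Type*} [CommRing R]

theorem smodEq_span_pow_iff {q : R} {k : ℕ} {x y : R} :
    x ≡ y [SMOD (Ideal.span {q} ^ k • ⊤ : Submodule R R)] ↔ q ^ k ∣ x - y := by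
  rw [SModEq.sub_mem, smul_eq_mul, Ideal.mul_top, Ideal.span_singleton_pow,
    Ideal.mem_span_singleton]

theorem exists_limit_of_dvd {q : R} [IsAdicComplete (Ideal.span {q}) R] (x : ℕ → R)
    (hx : ∀ k, q ^ k ∣ x k - x (k + 1)) : ∃ y, ∀ k, q ^ k ∣ x k - y := by
  have hc : AdicCompletion.IsAdicCauchy (Ideal.span {q}) R x :=
    (AdicCompletion.isAdicCauchy_iff (Ideal.span {q}) R x).2
    fun k => smodEq_span_pow_iff.2 (hx k)
  obtain ⟨y, hy⟩ := IsPrecomplete.prec (I := Ideal.span {q}) inferInstance hc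
  exact ⟨y, fun k => smodEq_span_pow_iff.1 (hy k)⟩

theorem eq_zero_of_forall_pow_dvd {q : R} [IsAdicComplete (Ideal.span {q}) R] {x : R}
    (hx : ∀ k, q ^ k ∣ x) : x = 0 :=
  IsHausdorff.haus (I := Ideal.span {q}) inferInstance x fun k =>
    smodEq_span_pow_iff.2 (by rw [sub_zero]; exact hx k)

/-- Nakayama's lemma over R: left and right multiplication by v are surjective modulo q, which lies
in the Jacobson radical, hence surjective. So v has inverses on both sides. -/
theorem isUnit_of_sub_one_mem_multiples {A : Type*} [Ring A] [Algebra R A] [Module.Finite R A]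
    {q : R} [IsAdicComplete (Ideal.span {q}) R] {v : A} (hv : v - 1 ∈ multiples A q) :
    IsUnit v := by
  have main (N : Submodule R A) (hN : ∀ y, ∃ z ∈ multiples A q, y - z ∈ N) : N = ⊤ := by
    refine top_le_iff.1 (Submodule.le_of_le_smul_of_le_jacobson_bot (I := Ideal.span {q})
      Module.Finite.fg_top (IsAdicComplete.le_jacobson_bot _) fun y _ => ?_)
    obtain ⟨_, ⟨c, rfl⟩, hz⟩ := hN y
    rw [← sub_add_cancel y]
    exact Submodule.add_mem_sup hz (Submodule.smul_mem_smul (Ideal.mem_span_singleton_self q) trivial)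
  have h1 : LinearMap.range (LinearMap.mulLeft R v) = ⊤ :=
    main _ fun y => ⟨-((v - 1) * y), neg_mem (mul_mem_multiples_right _ hv), y, by
      rw [LinearMap.mulLeft_apply]; noncomm_ring⟩
  have h2 : LinearMap.range (LinearMap.mulRight R v) = ⊤ :=
    main _ fun y => ⟨-(y * (v - 1)), neg_mem (mul_mem_multiples_left _ hv), y, by
      rw [LinearMap.mulRight_apply]; noncomm_ring⟩
  obtain ⟨a, ha⟩ := LinearMap.range_eq_top.1 h1 1
  obtain ⟨b, hb⟩ := LinearMap.range_eq_top.1 h2 1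
  rw [LinearMap.mulLeft_apply] at ha
  rw [LinearMap.mulRight_apply] at hb
  exact isUnit_iff_exists.2 ⟨a, ha, by rwa [← left_inv_eq_right_inv hb ha]⟩

end Complete

/-! ### Successive approximation by commutators -/

section GroupAlgebra

variable {R : Type*} [CommRing R] {G : Type*} [Group G]

/-- A representative of the conjugacy class of `h`. -/
noncomputable def conjRep (h : G) : G := (ConjClasses.mk h).out

theorem isConj_conjRep (h : G) : IsConj h (conjRep h) :=
  ConjClasses.mk_eq_mk_iff_isConj.1 (Quotient.out_eq (ConjClasses.mk h)).symm

theorem conjRep_eq_of_isConj {h h' : G} (hc : IsConj h h') : conjRep h = conjRep h' := by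
  rw [conjRep, conjRep, ConjClasses.mk_eq_mk_iff_isConj.2 hc]

/-- An element which conjugates `h` to the representative of its conjugacy class. -/
noncomputable def conjugator (h : G) : G := (isConj_iff.1 (isConj_conjRep h)).choose

theorem conjugator_spec (h : G) : conjugator h * h * (conjugator h)⁻¹ = conjRep h :=
  (isConj_iff.1 (isConj_conjRep h)).choose_spec

/-- A group element as a unit of the group algebra. -/
noncomputable def groupUnit (g : G) : (MonoidAlgebra R G)ˣ :=
  Units.map (MonoidAlgebra.of R G) (toUnits g)

theorem conj_single (h : G) (r : R) :
    (groupUnit (conjugator h) : (MonoidAlgebra R G)ˣ) * MonoidAlgebra.single h r *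
      ((groupUnit (conjugator h))⁻¹ : (MonoidAlgebra R G)ˣ) =
        MonoidAlgebra.single (conjRep h) r := by
  change MonoidAlgebra.single _ 1 * _ * MonoidAlgebra.single _ 1 = _
  rw [MonoidAlgebra.single_mul_single, MonoidAlgebra.single_mul_single, one_mul, mul_one,
    ← conjugator_spec h]
  rfl

-- This keeps the determinant hypothesis intact when v is divided by a product of commutators.
open scoped IsMulCommutative in
theorem det_inducedRep_of_mem_commutator {v : (MonoidAlgebra R G)ˣ}
    (hv : v ∈ commutator (MonoidAlgebra R G)ˣ) (g : G)
    [Fintype (G ⧸ Subgroup.zpowers g)] [DecidableEq (G ⧸ Subgroup.zpowers g)] :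
    (inducedRep R (Subgroup.zpowers g) v).det = 1 := by
  let d := Units.map ((Matrix.detMonoidHom (n := G ⧸ Subgroup.zpowers g)
    (R := MonoidAlgebra R (Subgroup.zpowers g))).comp
      (inducedRep R (Subgroup.zpowers g)).toRingHom.toMonoidHom)
  have : d v = 1 := Abelianization.commutator_subset_ker d hv
  exact congrArg Units.val this

variable [Fintype G]

theorem mem_multiples_iff_coeff {q : R} {x : MonoidAlgebra R G} :
    x ∈ multiples (MonoidAlgebra R G) q ↔ ∀ h, q ∣ x.coeff h := by
  constructor
  · rintro ⟨c, rfl⟩ h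
    exact ⟨c.coeff h, rfl⟩
  · intro hx
    choose c hc using hx
    refine ⟨MonoidAlgebra.ofCoeff (Finsupp.equivFunOnFinite.symm c), ?_⟩
    ext h
    exact (hc h).symm

/-- An element of the group algebra whose sums over the conjugacy classes are multiples of `q` is
modulo `q` a sum of differences of conjugates. -/
theorem sub_sum_mem_multiples {q : R} {y : MonoidAlgebra R G} (hy : ∀ g, q ∣ classSum g y) :
    y - ∑ h, (MonoidAlgebra.single h (y.coeff h) - MonoidAlgebra.single (conjRep h) (y.coeff h)) ∈
      multiples (MonoidAlgebra R G) q := by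
  classical
  have e : ∑ h, MonoidAlgebra.single h (y.coeff h) = y := by
    ext g
    simp [MonoidAlgebra.coeff_sum]
  -- What is left is the sum of y_h times the representative of the class of h. Its coefficient at g
  -- is a class sum if g is a representative, and 0 otherwise.
  rw [Finset.sum_sub_distrib, e, sub_sub_cancel, mem_multiples_iff_coeff]
  intro g
  rw [MonoidAlgebra.coeff_sum, Finsupp.finsetSum_apply]
  simp only [MonoidAlgebra.coeff_single, Finsupp.single_apply]
  by_cases hg : conjRep g = g
  · convert hy g using 1
    rw [classSum_apply, Finset.sum_filter]
    refine Finset.sum_congr rfl fun h _ => if_congr ⟨fun hh => ?_, fun hh => ?_⟩ rfl rfl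
    · exact (hh ▸ isConj_conjRep h).symm
    · rw [← conjRep_eq_of_isConj hh, hg]
  · rw [Finset.sum_eq_zero]
    · exact dvd_zero _
    · intro h _
      rw [if_neg]
      rintro rfl
      exact hg (conjRep_eq_of_isConj (isConj_conjRep h)).symm

variable {p : ℕ} [IsAdicComplete (Ideal.span {(p : R)}) R] {n : ℕ}

theorem isUnit_one_add_pow_smul (hn : n ≠ 0) (x : MonoidAlgebra R G) : IsUnit (1 + (p : R) ^ n • x) :=
  isUnit_of_sub_one_mem_multiples (q := (p : R)) (by
    rw [add_sub_cancel_left]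
    exact multiples_le_of_dvd (dvd_pow_self _ hn) (smul_mem_multiples _ _))

variable (hn : n ≠ 0)

/-- The commutator of `1 + pⁿ r h` with the chosen conjugator of `h`. -/
noncomputable def conjCommutator (r : G → R) (h : G) : (MonoidAlgebra R G)ˣ :=
  (isUnit_one_add_pow_smul (p := p) hn (MonoidAlgebra.single h (r h))).unit *
    groupUnit (conjugator h) *
    (isUnit_one_add_pow_smul (p := p) hn (MonoidAlgebra.single h (r h))).unit⁻¹ *
    (groupUnit (conjugator h))⁻¹

/-- The product of the commutators `conjCommutator` over the group. -/
noncomputable def conjCommutatorProd (r : G → R) : (MonoidAlgebra R G)ˣ :=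
  ((Finset.univ : Finset G).toList.map (conjCommutator (p := p) hn r)).prod

theorem conjCommutatorProd_mem_commutator (r : G → R) :
    conjCommutatorProd (p := p) hn r ∈ commutator (MonoidAlgebra R G)ˣ := by
  refine Subgroup.list_prod_mem _ fun x hx => ?_
  obtain ⟨h, _, rfl⟩ := List.mem_map.1 hx
  exact Subgroup.commutator_mem_commutator (Subgroup.mem_top _) (Subgroup.mem_top _)

theorem conjCommutator_sub_one_mem (r : G → R) (h : G) :
    ((conjCommutator (p := p) hn r h : (MonoidAlgebra R G)ˣ) : MonoidAlgebra R G) - 1 ∈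
      multiples _ ((p : R) ^ n) :=
  commutator_sub_one_mem_multiples (by
    rw [IsUnit.unit_spec, add_sub_cancel_left]
    exact smul_mem_multiples _ _) _

theorem conjCommutatorProd_sub_one_mem (r : G → R) :
    ((conjCommutatorProd (p := p) hn r : (MonoidAlgebra R G)ˣ) : MonoidAlgebra R G) - 1 ∈
      multiples _ ((p : R) ^ n) :=
  list_prod_sub_one_mem_multiples _ (conjCommutator_sub_one_mem hn r) _

/-- First order expansion of `conjCommutatorProd`. -/
theorem conjCommutatorProd_add_sub_mem (r s : G → R) (k : ℕ) :
    ((conjCommutatorProd (p := p) hn (r + (p : R) ^ k • s) : (MonoidAlgebra R G)ˣ) :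
      MonoidAlgebra R G) - conjCommutatorProd (p := p) hn r - (p : R) ^ (n + k) •
        ∑ h, (MonoidAlgebra.single h (s h) - MonoidAlgebra.single (conjRep h) (s h)) ∈
      multiples _ ((p : R) ^ (n + k + 1)) := by
  have hle : multiples (MonoidAlgebra R G) ((p : R) ^ n) ≤ multiples _ (p : R) :=
    multiples_le_of_dvd (dvd_pow_self _ hn)
  rw [← Finset.sum_map_toList, pow_succ]
  refine list_prod_sub_mem_multiples _ _ _
    (fun i => hle (conjCommutator_sub_one_mem hn _ i))
    (fun i => hle (conjCommutator_sub_one_mem hn _ i)) (fun h => ?_) _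
  rw [← conj_single]
  refine commutator_sub_mem_multiples (hle ?_) (hle ?_) ?_ _
  · rw [IsUnit.unit_spec, add_sub_cancel_left]
    exact smul_mem_multiples _ _
  · rw [IsUnit.unit_spec, add_sub_cancel_left]
    exact smul_mem_multiples _ _
  · rw [IsUnit.unit_spec, IsUnit.unit_spec, pow_add, mul_smul, add_assoc, ← smul_add]
    simp [MonoidAlgebra.single_add]

variable [∀ g : G, Fintype (G ⧸ Subgroup.zpowers g)]
  [∀ g : G, DecidableEq (G ⧸ Subgroup.zpowers g)]

open scoped IsMulCommutative in
theorem exists_improve [IsDomain R] [CharZero R] (hp : p.Prime) (hpn : 2 < p ^ n)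
    {v : (MonoidAlgebra R G)ˣ}
    (hv : ∀ g : G, (inducedRep R (Subgroup.zpowers g) v).det = 1) (k : ℕ) (r : G → R)
    (hr : (v : MonoidAlgebra R G) - conjCommutatorProd (p := p) hn r ∈
      multiples _ ((p : R) ^ (n + k))) :
    ∃ s : G → R, (v : MonoidAlgebra R G) -
      conjCommutatorProd (p := p) hn (r + (p : R) ^ k • s) ∈
        multiples _ ((p : R) ^ (n + k + 1)) := by
  obtain ⟨y, hy⟩ := mem_multiples.1 hr
  set Φ := conjCommutatorProd (p := p) hn r with hΦ
  have hΦ1 : ((Φ⁻¹ : (MonoidAlgebra R G)ˣ) : MonoidAlgebra R G) - 1 ∈ multiples _ (p : R) :=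
    inv_sub_one_mem_multiples (multiples_le_of_dvd (dvd_pow_self _ hn)
      (conjCommutatorProd_sub_one_mem hn r))
  have hquot : ((v * Φ⁻¹ : (MonoidAlgebra R G)ˣ) : MonoidAlgebra R G) =
      1 + (p : R) ^ (n + k) • (y * (Φ⁻¹ : (MonoidAlgebra R G)ˣ)) := by
    rw [← smul_mul_assoc, hy, sub_mul, Units.mul_inv, Units.val_mul, add_sub_cancel]
  have hpN : 2 < p ^ (n + k) :=
    hpn.trans_le (Nat.pow_le_pow_right hp.pos (Nat.le_add_right _ _))
  -- The quotient v Φ⁻¹ is 1 + p^(n+k) y Φ⁻¹ with all determinants 1. As Φ⁻¹ ≡ 1 mod p, the elements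
  -- y Φ⁻¹ and y have the same class sums modulo p.
  have hdvd (g : G) : (p : R) ∣ classSum g y := by
    have h1 : (p : R) ∣ classSum g (y * (Φ⁻¹ : (MonoidAlgebra R G)ˣ)) := by
      refine dvd_classSum hp hpN _ g ?_
      rw [← hquot, Units.val_mul, map_mul, Matrix.det_mul, hv g, one_mul]
      exact det_inducedRep_of_mem_commutator
        (inv_mem (conjCommutatorProd_mem_commutator hn r)) g
    obtain ⟨c, hc⟩ := mem_multiples.1 (mul_mem_multiples_left y hΦ1)
    have h2 : y * (Φ⁻¹ : (MonoidAlgebra R G)ˣ) = (p : R) • c + y := by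
      rw [hc, mul_sub, mul_one, sub_add_cancel]
    rw [h2, map_add, classSum_smul] at h1
    exact (dvd_add_right (dvd_mul_right _ _)).1 h1
  -- The change p^k s alters Φ to first order by p^(n+k) times the sum of s_h (h - `conjRep` h).
  -- With s the coefficients of y this sum is y modulo p, as the class sums vanish there.
  refine ⟨y.coeff, ?_⟩
  have h3 := conjCommutatorProd_add_sub_mem (p := p) hn r y.coeff k
  obtain ⟨c, hc⟩ := mem_multiples.1 (sub_sum_mem_multiples hdvd)
  generalize ∑ h, (MonoidAlgebra.single h (y.coeff h) -
    MonoidAlgebra.single (conjRep h) (y.coeff h)) = s at *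
  have h4 : (p : R) ^ (n + k + 1) • c = (p : R) ^ (n + k) • y - (p : R) ^ (n + k) • s := by
    rw [pow_succ, mul_smul, hc, smul_sub]
  have h5 := sub_mem (smul_mem_multiples ((p : R) ^ (n + k + 1)) c) h3
  rw [h4, hy] at h5
  convert h5 using 1
  abel

open scoped IsMulCommutative in
/-- A unit congruent to `1` modulo `pⁿ > 2`, all of whose determinants in the representations
induced from cyclic subgroups are `1`, is a product of commutators of units congruent to `1` modulo
`pⁿ` with group elements. -/
theorem exists_eq_conjCommutatorProd [IsDomain R] [CharZero R] (hp : p.Prime) (hpn : 2 < p ^ n)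
    {v : (MonoidAlgebra R G)ˣ}
    (hv1 : (v : MonoidAlgebra R G) - 1 ∈ multiples _ ((p : R) ^ n))
    (hv : ∀ g : G, (inducedRep R (Subgroup.zpowers g) v).det = 1) :
    ∃ r : G → R, v = conjCommutatorProd (p := p) hn r := by
  let P (k : ℕ) (r : G → R) : Prop := (v : MonoidAlgebra R G) -
    conjCommutatorProd (p := p) hn r ∈ multiples _ ((p : R) ^ (n + k))
  have step (k : ℕ) (r : {r // P k r}) : ∃ s : G → R, P (k + 1) (r.1 + (p : R) ^ k • s) :=
    exists_improve hn hp hpn hv k r.1 r.2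
  choose s hs using step
  have h0 : P 0 0 := by
    change _ - _ ∈ _
    rw [← sub_sub_sub_cancel_right _ _ (1 : MonoidAlgebra R G), add_zero]
    exact sub_mem hv1 (conjCommutatorProd_sub_one_mem hn 0)
  let r : (k : ℕ) → {r // P k r} := fun k =>
    Nat.rec (motive := fun k => {r // P k r}) ⟨0, h0⟩ (fun k r => ⟨_, hs k r⟩) k
  have hr (k : ℕ) (h : G) : (p : R) ^ k ∣ (r k).1 h - (r (k + 1)).1 h := by
    refine ⟨-s k (r k) h, ?_⟩
    change (r k).1 h - ((r k).1 h + (p : R) ^ k * s k (r k) h) = _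
    ring
  choose L hL using fun h => exists_limit_of_dvd (fun k => (r k).1 h) fun k => hr k h
  refine ⟨L, Units.ext (sub_eq_zero.1 ?_)⟩
  ext h
  refine eq_zero_of_forall_pow_dvd (q := (p : R)) fun k => ?_
  -- Continuity in the parameters: the limit differs from the k-th approximation by a multiple of
  -- p^k, so the two products agree modulo p^(n+k).
  choose t ht using fun h => hL h k
  have hLt : L = (r k).1 + (p : R) ^ k • -t := by
    ext h
    have := ht h
    simp only [Pi.add_apply, Pi.smul_apply, Pi.neg_apply, smul_eq_mul, mul_neg]
    rw [← this]
    ring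
  have h1 := multiples_le_of_dvd (pow_dvd_pow (p : R) (n + k).le_succ)
    (conjCommutatorProd_add_sub_mem (p := p) hn (r k).1 (-t) k)
  rw [← hLt] at h1
  have h2 := sub_mem (r k).2 (add_mem h1 (smul_mem_multiples _
    (∑ h, (MonoidAlgebra.single h ((-t) h) - MonoidAlgebra.single (conjRep h) ((-t) h)))))
  rw [sub_add_cancel, sub_sub_sub_cancel_right] at h2
  exact mem_multiples_iff_coeff.1 (multiples_le_of_dvd (pow_dvd_pow _ (Nat.le_add_left k n)) h2) h

-- Stable elementarity forces all the determinants of v to be 1, so v is a product of the special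
-- commutators. The lemma is applied with H = `relElem`.
open scoped IsMulCommutative in
theorem dilation_mem_of_mem_range [IsDomain R] [CharZero R] (hp : p.Prime) (hpn : 2 < p ^ n)
    (H : Subgroup (StableGL (MonoidAlgebra R G)))
    (hH : ∀ (w g : (MonoidAlgebra R G)ˣ) (x : MonoidAlgebra R G),
      (w : MonoidAlgebra R G) = 1 + (p : R) ^ n • x → dilation 0 (w * g * w⁻¹ * g⁻¹) ∈ H)
    {v : (MonoidAlgebra R G)ˣ}
    (hv : (v : MonoidAlgebra R G) - 1 ∈ multiples _ ((p : R) ^ n))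
    (hrange : dilation 0 v ∈ (St.toGL (MonoidAlgebra R G)).range) : dilation 0 v ∈ H := by
  have hn : n ≠ 0 := by rintro rfl; simp at hpn
  obtain ⟨r, rfl⟩ := exists_eq_conjCommutatorProd hn hp hpn hv fun g =>
    det_eq_one_of_dilation_mem_range (inducedRep R (Subgroup.zpowers g)).toRingHom hrange
  refine Subgroup.list_prod_mem (H.comap (dilationHom 0)) fun x hx => ?_
  obtain ⟨h, _, rfl⟩ := List.mem_map.1 hx
  exact hH _ _ _ (IsUnit.unit_spec _)

end GroupAlgebra

end AlgK

/-! ### The theorem for reduction modulo p^n -/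

theorem theorem3 {R : Type*} [CommRing R] [IsDomain R] [IsNoetherianRing R] [CharZero R]
    (p : ℕ) (hp : p.Prime) [IsAdicComplete (Ideal.span {(p : R)}) R]
    {G : Type*} [Group G] [Finite G] (n : ℕ) (hn : 2 < p ^ n) :
    Function.Surjective
      (AlgK.K₂.map
        (MonoidAlgebra.mapRingHom G
          (Ideal.Quotient.mk (Ideal.span {(p : R) ^ n})))) := by
  classical
  have := Fintype.ofFinite G
  have hn0 : n ≠ 0 := by rintro rfl; simp at hn
  have hker {s : MonoidAlgebra R G} (hs : MonoidAlgebra.mapRingHom G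
      (Ideal.Quotient.mk (Ideal.span {(p : R) ^ n})) s = 1) :
      s - 1 ∈ AlgK.multiples _ ((p : R) ^ n) := by
    rw [← map_one (MonoidAlgebra.mapRingHom G (Ideal.Quotient.mk (Ideal.span {(p : R) ^ n}))),
      ← sub_eq_zero, ← map_sub] at hs
    refine AlgK.mem_multiples_iff_coeff.2 fun h => ?_
    rw [← Ideal.mem_span_singleton, ← Ideal.Quotient.eq_zero_iff_mem,
      ← MonoidAlgebra.coeff_mapRingHom, hs]
    rfl
  have hker' (x : MonoidAlgebra R G) : MonoidAlgebra.mapRingHom G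
      (Ideal.Quotient.mk (Ideal.span {(p : R) ^ n})) (1 + (p : R) ^ n • x) = 1 := by
    rw [map_add, map_one, add_eq_left]
    ext h
    rw [MonoidAlgebra.coeff_mapRingHom]
    exact Ideal.Quotient.eq_zero_iff_mem.2
      (Ideal.mem_span_singleton.2 (AlgK.mem_multiples_iff_coeff.1 (AlgK.smul_mem_multiples _ x) h))
  refine AlgK.K₂.map_surjective_of (MonoidAlgebra.map_surjective _ Ideal.Quotient.mk_surjective)
    (fun s hs => ?_) fun s hs hrange => ?_
  · exact AlgK.isUnit_of_sub_one_mem_multiples (q := (p : R))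
      (AlgK.multiples_le_of_dvd (dvd_pow_self _ hn0) (hker hs))
  · refine AlgK.dilation_mem_of_mem_range hp hn _ (fun w g x hw => ?_) (hker hs) hrange
    exact AlgK.dilation_commutator_mem_relElem (hw ▸ hker' x) g
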